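/- For every $k \in \mathbb{N}$, $$\mathrm{BRoot}_{\leq 2k+1} \;\leq_{\mathrm W}\; \mathrm{AoUC}_{[0,1]} \times \mathrm{C}_{3^k},$$ where $\leq_{\mathrm W}$ is Weihrauch reducibility between multivalued functions on represented spaces: $f \leq_{\mathrm W} g$ if there are computable partial functions $H, K :\subseteq \mathbb{N}^{\mathbb{N}} \to \mathbb{N}^{\mathbb{N}}$ such that, for every realizer $G$ of $g$, the function $p \mapsto K\langle p, G(H(p))\rangle$ is a realizer of $f$ (a realizer of $f :\subseteq X \rightrightarrows Y$ is a partial function on $\mathbb{N}^{\mathbb{N}}$ that maps every name of every $x \in \operatorname{dom} f$ to a name of some element of $f(x)$). Here: - $\mathrm{BRoot}_{\leq n} :\subseteq \mathbb{R}[X] \rightrightarrows [0,1]$ has as its domain the real polynomials of degree at most $n$ (including the zero polynomial). A valid output for $P$ is any root of $P$ in $[0,1]$ if there is one, and any $x \in [0,1]$ if there is none. A real number is represented by a sequence of rationals $(q_n)_n$ with $|q_n - x| < 2^{-n}$, and a polynomial by some upper bound $d$ on its degree together with names of its coefficients of index at most $d$. - $\mathrm{AoUC}_{[0,1]}$ (all-or-unique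 choice) takes a closed set $A \subseteq [0,1]$ that is either all of $[0,1]$ or a singleton, given by an enumeration of rational open intervals that exhaust the complement of $A$ in $[0,1]$. A valid output is any $x \in A$. - $\mathrm{C}_m$ (finite closed choice) takes a non-empty set $A \subseteq \{0,\dots,m-1\}$, given by an enumeration of its (possibly empty) complement. A valid output is any $i \in A$. - $f \times g$ takes a pair of an input for $f$ and an input for $g$ and returns a pair of valid outputs. -/

import Mathlib

open Polynomial

namespace Weihrauch

/-! ## Computable functions on Baire space -/

/-- The prefix of length `m` of an infinite sequence. -/
def take (p : ℕ → ℕ) (m : ℕ) : List ℕ := (List.range m).map p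

/-- `φ` is monotone for the prefix order on words. -/
def PrefixMonotone (φ : List ℕ → List ℕ) : Prop :=
  ∀ u v : List ℕ, u <+: v → φ u <+: φ v

/-- A partial function `F` on Baire space is computable if some computable monotone word function
`φ` satisfies `F p = sup_m φ (p restricted to m)` for all `p` in the domain of `F`. This is
computation by a type-2 machine: `φ u` is what has been written on the output tape once the
prefix `u` of the input has been read. (By monotonicity all entries of all the words
`φ (take p m)` agree with `F p`.) -/
def ComputableFun (F : (ℕ → ℕ) →. (ℕ → ℕ)) : Prop :=
  ∃ φ : List ℕ → List ℕ, Computable φ ∧ PrefixMonotone φ ∧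
    ∀ p q, q ∈ F p → ∀ i, ∃ m, (φ (take p m))[i]? = some (q i)

/-- The pairing `⟨p, q⟩` of Baire space. -/
def interleave (p q : ℕ → ℕ) : ℕ → ℕ := fun n => if n % 2 = 0 then p (n / 2) else q (n / 2)

/-! ## Represented spaces -/

/-- A representation of `X`: a partial surjection from Baire space onto `X`, given by its graph;
`Names p x` says that `p` is a name of `x`. -/
class Represented (X : Type*) where
  Names : (ℕ → ℕ) → X → Prop
  unique : ∀ p x y, Names p x → Names p y → x = y
  exists_name : ∀ x, ∃ p, Names p x

open Represented (Names)

/-! ## Multivalued functions and Weihrauch reducibility -/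

/-- A partial multivalued function `f :⊆ X ⇉ Y`. Its domain is `{x | (f x).Nonempty}`. -/
abbrev MultiFun (X Y : Type*) := X → Set Y

/-- `F` realizes `f`: it maps each name of each `x` in the domain of `f` to a name of some
element of `f x`. -/
def Realizes {X Y : Type*} [Represented X] [Represented Y]
    (F : (ℕ → ℕ) →. (ℕ → ℕ)) (f : MultiFun X Y) : Prop :=
  ∀ p x, Names p x → (f x).Nonempty → ∃ q ∈ F p, ∃ y ∈ f x, Names q y

/-- Weihrauch reducibility `f ≤_W g`: there are computable `H` and `K` such that for every
realizer `G` of `g`, the function `p ↦ K ⟨p, G (H p)⟩` realizes `f`. -/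
def Reducible {X Y Z W : Type*} [Represented X] [Represented Y] [Represented Z] [Represented W]
    (f : MultiFun X Y) (g : MultiFun Z W) : Prop :=
  ∃ H K : (ℕ → ℕ) →. (ℕ → ℕ), ComputableFun H ∧ ComputableFun K ∧
    ∀ G : (ℕ → ℕ) →. (ℕ → ℕ), Realizes G g →
      Realizes (fun p => (H p).bind fun h => (G h).bind fun q => K (interleave p q)) f

/-- The product `f × g`: solve an instance of `f` and an instance of `g` in parallel. -/
def prod {X Y Z W : Type*} (f : MultiFun X Y) (g : MultiFun Z W) : MultiFun (X × Z) (Y × W) :=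
  fun a => f a.1 ×ˢ g a.2

instance {X Y : Type*} [Represented X] [Represented Y] : Represented (X × Y) where
  Names p a := Names (fun n => p (2 * n)) a.1 ∧ Names (fun n => p (2 * n + 1)) a.2
  unique p a b ha hb :=
    Prod.ext (Represented.unique _ _ _ ha.1 hb.1) (Represented.unique _ _ _ ha.2 hb.2)
  exists_name a := by
    obtain ⟨p, hp⟩ := Represented.exists_name a.1
    obtain ⟨q, hq⟩ := Represented.exists_name a.2
    refine ⟨interleave p q, ?_, ?_⟩
    · convert hp using 2
      simp [interleave]
    · convert hq using 2 with n
      have h1 : (2 * n + 1) % 2 = 1 := by omega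
      have h2 : (2 * n + 1) / 2 = n := by omega
      simp [interleave, h1, h2]

/-! ## Real numbers -/

/-- A standard numbering of the rational numbers: the code `⟨⟨a, b⟩, c⟩` denotes
`(a - b) / (c + 1)`. -/
def ratOf (n : ℕ) : ℚ :=
  ((n.unpair.1.unpair.1 : ℚ) - (n.unpair.1.unpair.2 : ℚ)) / ((n.unpair.2 : ℚ) + 1)

theorem ratOf_surjective : Function.Surjective ratOf := by
  intro r
  have hd : (((r.den - 1 : ℕ) : ℚ) + 1) = r.den := by
    rw [Nat.cast_sub r.pos]; simp
  refine ⟨Nat.pair (Nat.pair r.num.toNat (-r.num).toNat) (r.den - 1), ?_⟩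
  have hn : ((r.num.toNat : ℚ) - ((-r.num).toNat : ℚ)) = r.num := by
    have h := Int.toNat_sub_toNat_neg r.num
    exact_mod_cast congrArg (Int.cast : ℤ → ℚ) h
  simp only [ratOf, Nat.unpair_pair, hd, hn]
  exact Rat.num_div_den r

/-- A name of a real number `x` is a sequence of rationals `q₀, q₁, …` with `|qₙ - x| < 2⁻ⁿ`. -/
def NamesReal (p : ℕ → ℕ) (x : ℝ) : Prop := ∀ n, |(ratOf (p n) : ℝ) - x| < 2⁻¹ ^ n

theorem NamesReal.unique {p : ℕ → ℕ} {x y : ℝ} (hx : NamesReal p x) (hy : NamesReal p y) :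
    x = y := by
  have h : Filter.Tendsto (fun n : ℕ => (2⁻¹ : ℝ) ^ n) Filter.atTop (nhds 0) :=
    tendsto_pow_atTop_nhds_zero_of_lt_one (by norm_num) (by norm_num)
  have key : ∀ z, NamesReal p z →
      Filter.Tendsto (fun n => (ratOf (p n) : ℝ)) Filter.atTop (nhds z) := fun z hz =>
    tendsto_iff_dist_tendsto_zero.2
      (squeeze_zero (fun _ => dist_nonneg) (fun n => (hz n).le) h)
  exact tendsto_nhds_unique (key x hx) (key y hy)

theorem exists_namesReal (x : ℝ) : ∃ p, NamesReal p x := by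
  have h : ∀ n : ℕ, ∃ c, |(ratOf c : ℝ) - x| < 2⁻¹ ^ n := by
    intro n
    have hpos : (0 : ℝ) < 2⁻¹ ^ n := by positivity
    obtain ⟨r, h1, h2⟩ := exists_rat_btwn (show x < x + 2⁻¹ ^ n by linarith)
    obtain ⟨c, rfl⟩ := ratOf_surjective r
    exact ⟨c, abs_lt.2 ⟨by linarith, by linarith⟩⟩
  choose p hp using h
  exact ⟨p, hp⟩

instance : Represented ℝ where
  Names := NamesReal
  unique _ _ _ := NamesReal.unique
  exists_name := exists_namesReal

/-- The unit interval is a subspace of `ℝ`. -/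
instance : Represented unitInterval where
  Names p x := NamesReal p x
  unique _ _ _ hx hy := Subtype.ext (hx.unique hy)
  exists_name x := exists_namesReal x

/-! ## Real polynomials -/

/-- A name of a polynomial `P` consists of an upper bound `p 0 = d` on its degree and of names of
its coefficients of index at most `d`; digit `n` of the name of coefficient `i` is found at place
`⟨i, n⟩ + 1`. -/
instance : Represented ℝ[X] where
  Names p P := P.natDegree ≤ p 0 ∧
    ∀ i ≤ p 0, NamesReal (fun n => p (Nat.pair i n + 1)) (P.coeff i)
  unique p P Q hP hQ := by
    ext i
    rcases le_or_gt i (p 0) with hi | hi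
    · exact (hP.2 i hi).unique (hQ.2 i hi)
    · rw [coeff_eq_zero_of_natDegree_lt (hP.1.trans_lt hi),
        coeff_eq_zero_of_natDegree_lt (hQ.1.trans_lt hi)]
  exists_name P := by
    choose c hc using fun i => exists_namesReal (P.coeff i)
    refine ⟨fun m => Nat.casesOn m P.natDegree fun j => c j.unpair.1 j.unpair.2, le_rfl, ?_⟩
    intro i _
    simpa using hc i

/-- `BRoot` maps a real polynomial to a root in `[0,1]` if there is one, and to any element of
`[0,1]` otherwise. -/
def BRoot : MultiFun ℝ[X] unitInterval :=
  fun P => {x | (∃ y : unitInterval, P.IsRoot (y : ℝ)) → P.IsRoot (x : ℝ)}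

/-- The restriction of `BRoot` to the polynomials of degree at most `n`. -/
def BRootLE (n : ℕ) : MultiFun ℝ[X] unitInterval :=
  fun P => {x | P.degree ≤ n ∧ x ∈ BRoot P}

/-! ## All-or-unique choice on the unit interval -/

/-- The number `c` codes an open rational interval (an empty one if the end points are not in
increasing order); `InInterval c x` says that `x` belongs to it. -/
def InInterval (c : ℕ) (x : ℝ) : Prop :=
  (ratOf c.unpair.1 : ℝ) < x ∧ x < (ratOf c.unpair.2 : ℝ)

/-- The space `𝒜([0,1])` of closed subsets of `[0,1]`, represented by negative information: a name
of `A` lists open rational intervals that exhaust the complement of `A`. -/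
instance : Represented (TopologicalSpace.Closeds unitInterval) where
  Names p A := ∀ x : unitInterval, x ∈ A ↔ ∀ n, ¬ InInterval (p n) x
  unique p A B hA hB := by
    ext x
    exact (hA x).trans (hB x).symm
  exists_name A := by
    classical
    refine ⟨fun c => if ∀ y : unitInterval, InInterval c y → y ∉ A then c else Nat.pair 0 0, ?_⟩
    intro x
    constructor
    · intro hx n hn
      dsimp only at hn
      split_ifs at hn with h
      · exact h x hn hx
      · simp only [InInterval, Nat.unpair_pair] at hn
        exact absurd (hn.1.trans hn.2) (lt_irrefl _)
    · intro h
      by_contra hx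
      obtain ⟨ε, hε, hball⟩ := Metric.isOpen_iff.1 A.isClosed.isOpen_compl x hx
      obtain ⟨r, hr1, hr2⟩ := exists_rat_btwn (show (x : ℝ) - ε < x by linarith)
      obtain ⟨s, hs1, hs2⟩ := exists_rat_btwn (show (x : ℝ) < x + ε by linarith)
      obtain ⟨a, rfl⟩ := ratOf_surjective r
      obtain ⟨b, rfl⟩ := ratOf_surjective s
      have hc : ∀ y : unitInterval, InInterval (Nat.pair a b) y → y ∉ A := by
        intro y hy
        simp only [InInterval, Nat.unpair_pair] at hy
        refine hball (Metric.mem_ball.2 ?_)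
        rw [Subtype.dist_eq, Real.dist_eq]
        exact abs_lt.2 ⟨by linarith [hy.1], by linarith [hy.2]⟩
      refine h (Nat.pair a b) ?_
      dsimp only
      rw [if_pos hc]
      simp only [InInterval, Nat.unpair_pair]
      exact ⟨hr2, hs1⟩

/-- All-or-unique choice on `[0,1]`: given a closed subset of `[0,1]` that is either all of `[0,1]`
or a singleton, find an element of it. -/
def AoUC : MultiFun (TopologicalSpace.Closeds unitInterval) unitInterval :=
  fun A => {x | ((A : Set unitInterval) = Set.univ ∨
    ∃ a : unitInterval, (A : Set unitInterval) = {a}) ∧ x ∈ A}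

/-! ## Finite closed choice -/

/-- The discrete space `{0, …, k-1}`. -/
instance (k : ℕ) : Represented (Fin k) where
  Names p i := p 0 = i
  unique _ _ _ h h' := Fin.ext (h.symm.trans h')
  exists_name i := ⟨fun _ => i, rfl⟩

/-- The space of closed subsets of `{0, …, k-1}`: a name of `A` enumerates the complement of `A`,
where the entry `i + 1` removes `i`, and the entry `0` removes nothing. -/
instance (k : ℕ) : Represented (Set (Fin k)) where
  Names p A := ∀ i : Fin k, i ∈ A ↔ ∀ n, p n ≠ i + 1
  unique p A B hA hB := by
    ext i
    exact (hA i).trans (hB i).symm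
  exists_name A := by
    classical
    refine ⟨fun n => if ∃ i : Fin k, i ∉ A ∧ n = i + 1 then n else 0, ?_⟩
    intro i
    constructor
    · intro hi n hn
      dsimp only at hn
      split_ifs at hn with h
      obtain ⟨j, hj, rfl⟩ := h
      have : j = i := Fin.ext (by omega)
      exact hj (this ▸ hi)
    · intro h
      by_contra hi
      exact h (i + 1) (if_pos ⟨i, hi, rfl⟩)

/-- Finite closed choice `C_k`: given a nonempty subset of `{0, …, k-1}` by an enumeration of its
complement, find an element of it. -/
def C (k : ℕ) : MultiFun (Set (Fin k)) (Fin k) := fun A => A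

end Weihrauch

namespace Weihrauch

/-! ## Primitive recursive rational-valued functions -/

section PrimrecRat

variable {α : Type*} [Primcodable α]

/-! Put `N = 3 ^ k`; all that matters about it is that it is positive and at least `2 * k + 1`,
hence at least the degree of `P`.

If `P ≠ 0`, a search finds some `e` for which `P⁽ᵉ⁾` visibly has no zero on `[-1, 1]`, because one
coefficient dominates the higher ones (`exists_leadCert`). In the spirit of Budan and Fourier, the
number of sign changes in `P(a), …, P⁽ᵉ⁾(a)` does not increase with `a`, and drops strictly across
each root of `P` (`signChanges_le_and_lt`). So every root in `[0, 1]` is a threshold: for some `i <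
e ≤ N`, generic points `a` to its left have at least `i + 1` sign changes and those to its right
have fewer (`exists_threshold`). Thresholds are computable by trisection. The middle third of the
current interval contains a generic test point, signs there can be certified, and the interval
shrinks to its left or right two thirds. This gives `N` candidates, each an expansion in base `3 /
2`, which include all roots of `P` in `[0, 1]` (`IsDigitSequence.exists_digitLim_eq`).

The search does not terminate for `P = 0`; this is where `AoUC` is needed. The digits of all
candidates are interleaved into one sequence, coded by a point of a Cantor set in `[0, 1]`. As
digits appear, the closed set passed to `AoUC` shrinks to that point; if `P = 0` no digit ever
appears and the set remains `[0, 1]`. Decoding must accept every point of `[0, 1]`, so it uses the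
coordinates of a Schoenberg curve, total computable functions into `[0, 1]` that read off the digits
exactly on the Cantor set (`curve_codeLim`). For `P = 0` any decoded value is a root.

`C N` selects the candidate. An index is removed once `P` is certified to have no zero on the
current interval of that candidate. If `P` has no root in `[0, 1]` all indices would disappear, so
removals are suppressed from the moment all have been refuted (`exists_not_removed`). If there is a
root, its candidate is never refuted, nothing is suppressed, and exactly the candidates that are
roots survive. Removals depend on the name of `P` only, not on the answer of `AoUC`, so the two
questions can be asked in parallel. -/

theorem primrecPred_forall_lt {R : ℕ → α → Prop} (hR : PrimrecRel R) {n : α → ℕ}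
    (hn : Primrec n) : PrimrecPred fun a => ∀ x < n a, R x a :=
  (hR.forall_mem_list.comp (Primrec.list_range.comp hn) Primrec.id).of_eq (by simp)

theorem primrecPred_exists_lt {R : ℕ → α → Prop} (hR : PrimrecRel R) {n : α → ℕ}
    (hn : Primrec n) : PrimrecPred fun a => ∃ x < n a, R x a :=
  (hR.exists_mem_list.comp (Primrec.list_range.comp hn) Primrec.id).of_eq (by simp)

/-- `f` can be computed primitive recursively on codes of rational numbers. -/
def PrimrecRat (f : α → ℚ) : Prop := ∃ g : α → ℕ, Primrec g ∧ ∀ a, ratOf (g a) = f a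

/-- The code of `(a - b) / (c + 1)`. -/
def ratCode (a b c : ℕ) : ℕ := Nat.pair (Nat.pair a b) c

theorem ratOf_ratCode (a b c : ℕ) : ratOf (ratCode a b c) = ((a : ℚ) - b) / (c + 1) := by
  simp [ratOf, ratCode]

/-- Addition on codes of rational numbers. -/
def codeAdd (m n : ℕ) : ℕ :=
  ratCode
    (m.unpair.1.unpair.1 * (n.unpair.2 + 1) + n.unpair.1.unpair.1 * (m.unpair.2 + 1))
    (m.unpair.1.unpair.2 * (n.unpair.2 + 1) + n.unpair.1.unpair.2 * (m.unpair.2 + 1))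
    ((m.unpair.2 + 1) * (n.unpair.2 + 1) - 1)

/-- Multiplication on codes of rational numbers. -/
def codeMul (m n : ℕ) : ℕ :=
  ratCode
    (m.unpair.1.unpair.1 * n.unpair.1.unpair.1 + m.unpair.1.unpair.2 * n.unpair.1.unpair.2)
    (m.unpair.1.unpair.1 * n.unpair.1.unpair.2 + m.unpair.1.unpair.2 * n.unpair.1.unpair.1)
    ((m.unpair.2 + 1) * (n.unpair.2 + 1) - 1)

theorem cast_succ_mul_succ_sub_one (m n : ℕ) :
    (((m + 1) * (n + 1) - 1 : ℕ) : ℚ) + 1 = ((m : ℚ) + 1) * (n + 1) := by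
  rw [Nat.cast_sub (Nat.mul_pos m.succ_pos n.succ_pos)]
  push_cast
  ring

theorem ratOf_codeAdd (m n : ℕ) : ratOf (codeAdd m n) = ratOf m + ratOf n := by
  rw [codeAdd, ratOf_ratCode, cast_succ_mul_succ_sub_one, ratOf, ratOf]
  have h1 : ((m.unpair.2 : ℚ) + 1) ≠ 0 := by positivity
  have h2 : ((n.unpair.2 : ℚ) + 1) ≠ 0 := by positivity
  push_cast
  field_simp
  ring

theorem ratOf_codeMul (m n : ℕ) : ratOf (codeMul m n) = ratOf m * ratOf n := by
  rw [codeMul, ratOf_ratCode, cast_succ_mul_succ_sub_one, ratOf, ratOf]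
  have h1 : ((m.unpair.2 : ℚ) + 1) ≠ 0 := by positivity
  have h2 : ((n.unpair.2 : ℚ) + 1) ≠ 0 := by positivity
  push_cast
  field_simp
  ring

theorem ratOf_lt_iff (m n : ℕ) : ratOf m < ratOf n ↔
    m.unpair.1.unpair.1 * (n.unpair.2 + 1) + n.unpair.1.unpair.2 * (m.unpair.2 + 1) <
      n.unpair.1.unpair.1 * (m.unpair.2 + 1) + m.unpair.1.unpair.2 * (n.unpair.2 + 1) := by
  rw [ratOf, ratOf, div_lt_div_iff₀ (by positivity) (by positivity), ← Nat.cast_lt (α := ℚ)]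
  push_cast
  constructor <;> intro h <;> linarith

theorem primrec_num : Primrec fun n : ℕ => n.unpair.1.unpair.1 :=
  Primrec.fst.comp (Primrec.unpair.comp (Primrec.fst.comp Primrec.unpair))

theorem primrec_negNum : Primrec fun n : ℕ => n.unpair.1.unpair.2 :=
  Primrec.snd.comp (Primrec.unpair.comp (Primrec.fst.comp Primrec.unpair))

theorem primrec_den : Primrec fun n : ℕ => n.unpair.2 + 1 :=
  Primrec.succ.comp (Primrec.snd.comp Primrec.unpair)

theorem primrec_ratCode {f g h : α → ℕ} (hf : Primrec f) (hg : Primrec g) (hh : Primrec h) :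
    Primrec fun a => ratCode (f a) (g a) (h a) :=
  Primrec₂.natPair.comp (Primrec₂.natPair.comp hf hg) hh

theorem primrec_codeAdd : Primrec₂ codeAdd := by
  have f := Primrec.fst (α := ℕ) (β := ℕ)
  have s := Primrec.snd (α := ℕ) (β := ℕ)
  exact primrec_ratCode
    (Primrec.nat_add.comp (Primrec.nat_mul.comp (primrec_num.comp f) (primrec_den.comp s))
      (Primrec.nat_mul.comp (primrec_num.comp s) (primrec_den.comp f)))
    (Primrec.nat_add.comp (Primrec.nat_mul.comp (primrec_negNum.comp f) (primrec_den.comp s))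
      (Primrec.nat_mul.comp (primrec_negNum.comp s) (primrec_den.comp f)))
    (Primrec.nat_sub.comp (Primrec.nat_mul.comp (primrec_den.comp f) (primrec_den.comp s))
      (Primrec.const 1))

theorem primrec_codeMul : Primrec₂ codeMul := by
  have f := Primrec.fst (α := ℕ) (β := ℕ)
  have s := Primrec.snd (α := ℕ) (β := ℕ)
  exact primrec_ratCode
    (Primrec.nat_add.comp (Primrec.nat_mul.comp (primrec_num.comp f) (primrec_num.comp s))
      (Primrec.nat_mul.comp (primrec_negNum.comp f) (primrec_negNum.comp s)))
    (Primrec.nat_add.comp (Primrec.nat_mul.comp (primrec_num.comp f) (primrec_negNum.comp s))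
      (Primrec.nat_mul.comp (primrec_negNum.comp f) (primrec_num.comp s)))
    (Primrec.nat_sub.comp (Primrec.nat_mul.comp (primrec_den.comp f) (primrec_den.comp s))
      (Primrec.const 1))

namespace PrimrecRat

theorem ratOf {f : α → ℕ} (hf : Primrec f) : PrimrecRat fun a => ratOf (f a) :=
  ⟨f, hf, fun _ => rfl⟩

theorem const (q : ℚ) : PrimrecRat fun _ : α => q :=
  let ⟨c, hc⟩ := ratOf_surjective q
  ⟨fun _ => c, Primrec.const c, fun _ => hc⟩

theorem natCast {f : α → ℕ} (hf : Primrec f) : PrimrecRat fun a => (f a : ℚ) :=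
  ⟨fun a => ratCode (f a) 0 0, primrec_ratCode hf (Primrec.const 0) (Primrec.const 0),
    fun a => by simp [ratOf_ratCode]⟩

theorem comp {β : Type*} [Primcodable β] {f : β → ℚ} (hf : PrimrecRat f) {g : α → β}
    (hg : Primrec g) : PrimrecRat fun a => f (g a) :=
  let ⟨f', hf', h⟩ := hf
  ⟨fun a => f' (g a), hf'.comp hg, fun a => h (g a)⟩

theorem add {f g : α → ℚ} (hf : PrimrecRat f) (hg : PrimrecRat g) :
    PrimrecRat fun a => f a + g a := by
  obtain ⟨f', hf', h1⟩ := hf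
  obtain ⟨g', hg', h2⟩ := hg
  exact ⟨fun a => codeAdd (f' a) (g' a), primrec_codeAdd.comp hf' hg',
    fun a => by rw [ratOf_codeAdd, h1, h2]⟩

theorem mul {f g : α → ℚ} (hf : PrimrecRat f) (hg : PrimrecRat g) :
    PrimrecRat fun a => f a * g a := by
  obtain ⟨f', hf', h1⟩ := hf
  obtain ⟨g', hg', h2⟩ := hg
  exact ⟨fun a => codeMul (f' a) (g' a), primrec_codeMul.comp hf' hg',
    fun a => by rw [ratOf_codeMul, h1, h2]⟩

theorem of_eq {f g : α → ℚ} (hf : PrimrecRat f) (h : ∀ a, f a = g a) : PrimrecRat g :=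
  (funext h : f = g) ▸ hf

theorem neg {f : α → ℚ} (hf : PrimrecRat f) : PrimrecRat fun a => -f a :=
  ((const (-1)).mul hf).of_eq fun _ => neg_one_mul _

theorem sub {f g : α → ℚ} (hf : PrimrecRat f) (hg : PrimrecRat g) :
    PrimrecRat fun a => f a - g a :=
  (hf.add hg.neg).of_eq fun _ => (sub_eq_add_neg _ _).symm

theorem inv_succ {f : α → ℕ} (hf : Primrec f) : PrimrecRat fun a => ((f a : ℚ) + 1)⁻¹ :=
  ⟨fun a => ratCode 1 0 (f a), primrec_ratCode (Primrec.const 1) (Primrec.const 0) hf,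
    fun a => by simp [ratOf_ratCode]⟩

theorem lt {f g : α → ℚ} (hf : PrimrecRat f) (hg : PrimrecRat g) :
    PrimrecPred fun a => f a < g a := by
  obtain ⟨f', hf', h1⟩ := hf
  obtain ⟨g', hg', h2⟩ := hg
  refine PrimrecPred.of_eq ?_ fun a => (ratOf_lt_iff (f' a) (g' a)).symm.trans
    (iff_of_eq (by rw [h1, h2]))
  exact Primrec.nat_lt.comp
    (Primrec.nat_add.comp (Primrec.nat_mul.comp (primrec_num.comp hf') (primrec_den.comp hg'))
      (Primrec.nat_mul.comp (primrec_negNum.comp hg') (primrec_den.comp hf')))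
    (Primrec.nat_add.comp (Primrec.nat_mul.comp (primrec_num.comp hg') (primrec_den.comp hf'))
      (Primrec.nat_mul.comp (primrec_negNum.comp hf') (primrec_den.comp hg')))

theorem ite {c : α → Prop} [DecidablePred c] (hc : PrimrecPred c) {f g : α → ℚ}
    (hf : PrimrecRat f) (hg : PrimrecRat g) : PrimrecRat fun a => if c a then f a else g a := by
  obtain ⟨f', hf', h1⟩ := hf
  obtain ⟨g', hg', h2⟩ := hg
  refine ⟨fun a => if c a then f' a else g' a, Primrec.ite hc hf' hg', fun a => ?_⟩
  dsimp only
  split_ifs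
  · exact h1 a
  · exact h2 a

theorem max {f g : α → ℚ} (hf : PrimrecRat f) (hg : PrimrecRat g) :
    PrimrecRat fun a => max (f a) (g a) :=
  (ite (hf.lt hg) hg hf).of_eq fun a => by
    split_ifs with h
    · exact (max_eq_right h.le).symm
    · exact (max_eq_left (not_lt.1 h)).symm

theorem min {f g : α → ℚ} (hf : PrimrecRat f) (hg : PrimrecRat g) :
    PrimrecRat fun a => min (f a) (g a) :=
  (ite (hf.lt hg) hf hg).of_eq fun a => by
    split_ifs with h
    · exact (min_eq_left h.le).symm
    · exact (min_eq_right (not_lt.1 h)).symm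

theorem abs {f : α → ℚ} (hf : PrimrecRat f) : PrimrecRat fun a => |f a| :=
  hf.max hf.neg

theorem sum {f : α → ℕ → ℚ} (hf : PrimrecRat fun x : α × ℕ => f x.1 x.2) {n : α → ℕ}
    (hn : Primrec n) : PrimrecRat fun a => ∑ i ∈ Finset.range (n a), f a i := by
  obtain ⟨g, hg, h⟩ := hf
  refine ⟨fun a => (n a).rec (ratCode 0 0 0) fun i c => codeAdd c (g (a, i)), ?_, fun a => ?_⟩
  · exact Primrec.nat_rec' hn (Primrec.const _) (primrec_codeAdd.comp
      (Primrec.snd.comp Primrec.snd)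
      (hg.comp (Primrec.pair Primrec.fst (Primrec.fst.comp Primrec.snd)))).to₂
  · dsimp only
    induction n a with
    | zero => simp [ratOf_ratCode]
    | succ k ih => rw [ratOf_codeAdd, ih, h, Finset.sum_range_succ]

theorem pow {f : α → ℚ} (hf : PrimrecRat f) {n : α → ℕ} (hn : Primrec n) :
    PrimrecRat fun a => f a ^ n a := by
  obtain ⟨g, hg, h⟩ := hf
  refine ⟨fun a => (n a).rec (ratCode 1 0 0) fun _ c => codeMul c (g a), ?_, fun a => ?_⟩
  · exact Primrec.nat_rec' hn (Primrec.const _) (primrec_codeMul.comp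
      (Primrec.snd.comp Primrec.snd) (hg.comp Primrec.fst)).to₂
  · dsimp only
    induction n a with
    | zero => simp [ratOf_ratCode]
    | succ k ih => rw [ratOf_codeMul, ih, h, pow_succ]

theorem natFloor {f : α → ℚ} (hf : PrimrecRat f) : Primrec fun a => ⌊f a⌋₊ := by
  obtain ⟨g, hg, h⟩ := hf
  refine (Primrec.nat_div.comp (Primrec.nat_sub.comp (primrec_num.comp hg)
    (primrec_negNum.comp hg)) (primrec_den.comp hg)).of_eq fun a => ?_
  rw [← h a, Weihrauch.ratOf]
  -- Truncated subtraction of the numerators is harmless: for a negative rational it gives `0`,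
  -- which is also the value of `⌊·⌋₊`.
  rcases le_total ((g a).unpair.1.unpair.2) ((g a).unpair.1.unpair.1) with h1 | h1
  · rw [← Nat.cast_sub h1, ← Nat.cast_succ, Nat.floor_div_natCast, Nat.floor_natCast]
  · rw [Nat.sub_eq_zero_of_le h1, Nat.zero_div, eq_comm, Nat.floor_eq_zero]
    refine lt_of_le_of_lt (div_nonpos_of_nonpos_of_nonneg ?_ (by positivity)) one_pos
    exact sub_nonpos.2 (Nat.cast_le.2 h1)

end PrimrecRat

theorem primrec_descFactorial : Primrec₂ Nat.descFactorial := by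
  have h : Primrec₂ fun n k : ℕ => (k.rec 1 fun t c => (n - t) * c : ℕ) :=
    Primrec.nat_rec (Primrec.const 1) (Primrec.nat_mul.comp
      (Primrec.nat_sub.comp Primrec.fst (Primrec.fst.comp Primrec.snd))
      (Primrec.snd.comp Primrec.snd)).to₂
  refine h.of_eq fun n k => ?_
  induction k with
  | zero => rfl
  | succ k ih => rw [Nat.descFactorial_succ, ← ih]

end PrimrecRat

/-! ## Computable functions on Baire space with linear use -/

theorem take_length (p : ℕ → ℕ) (m : ℕ) : (take p m).length = m := by simp [take]

theorem take_take (p : ℕ → ℕ) {j m : ℕ} (h : j ≤ m) : (take p m).take j = take p j := by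
  rw [take, ← List.map_take, List.take_range, min_eq_left h, take]

theorem take_getD (p : ℕ → ℕ) {i m : ℕ} (h : i < m) : (take p m).getD i 0 = p i := by
  simp [take, List.getD_eq_getElem?_getD, h]

/-- From a prefix `u`, the machine writes the entries `n < u.length / c`. Entry `n` looks only at
the first `c * (n + 1)` symbols, so more input never alters what is written, and monotonicity
follows. -/
theorem computableFun_of_primrec {g : ℕ → List ℕ → ℕ} (hg : Primrec₂ g) {c : ℕ} (hc : 0 < c) :
    ComputableFun fun p => Part.some fun n => g n (take p (c * (n + 1))) := by
  refine ⟨fun u => (List.range (u.length / c)).map fun n => g n (u.take (c * (n + 1))), ?_, ?_, ?_⟩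
  · refine Primrec.to_comp (Primrec.list_map (Primrec.list_range.comp
      (Primrec.nat_div.comp Primrec.list_length (Primrec.const c))) ?_)
    exact (hg.comp Primrec.snd (Primrec.list_take.comp (Primrec.nat_mul.comp (Primrec.const c)
      (Primrec.succ.comp Primrec.snd)) Primrec.fst)).to₂
  · rintro u v ⟨w, rfl⟩
    have hle : u.length / c ≤ (u ++ w).length / c := Nat.div_le_div_right (by simp)
    rw [List.prefix_iff_eq_take]
    simp only [List.length_map, List.length_range]
    rw [← List.map_take, List.take_range, min_eq_left hle]
    refine List.map_congr_left fun n hn => ?_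
    have hn' : n + 1 ≤ u.length / c := List.mem_range.1 hn
    rw [List.take_append_of_le_length]
    rw [mul_comm]
    exact (Nat.le_div_iff_mul_le hc).1 hn'
  · intro p q hq i
    rw [Part.mem_some_iff] at hq
    subst hq
    refine ⟨c * (i + 1), ?_⟩
    simp [take_length, hc, take_take]

/-! ## Sign changes in the sequence of derivatives -/

/-- The number of sign changes in `P(a), P'(a), …, P⁽ᵉ⁾(a)`. -/
noncomputable def signChanges (P : ℝ[X]) (e : ℕ) (a : ℝ) : ℕ :=
  ∑ m ∈ Finset.range e,
    if (derivative^[m] P).eval a * (derivative^[m + 1] P).eval a < 0 then 1 else 0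

/-- None of `P, P', …, P⁽ᵉ⁾` vanishes at `a`. -/
def IsGeneric (P : ℝ[X]) (e : ℕ) (a : ℝ) : Prop := ∀ m ≤ e, (derivative^[m] P).eval a ≠ 0

theorem signChanges_le (P : ℝ[X]) (e : ℕ) (a : ℝ) : signChanges P e a ≤ e := by
  refine (Finset.sum_le_card_nsmul _ _ 1 fun m _ => ?_).trans (by simp)
  split_ifs <;> simp

theorem signChanges_succ (P : ℝ[X]) (e : ℕ) (a : ℝ) :
    signChanges P (e + 1) a = signChanges (derivative P) e a +
      if P.eval a * (derivative P).eval a < 0 then 1 else 0 := by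
  rw [signChanges, Finset.sum_range_succ']
  rfl

theorem IsGeneric.derivative {P : ℝ[X]} {e : ℕ} {a : ℝ} (h : IsGeneric P (e + 1) a) :
    IsGeneric (derivative P) e a := fun m hm => by
  simpa using h (m + 1) (by omega)

theorem IsGeneric.eval_ne_zero {P : ℝ[X]} {e : ℕ} {a : ℝ} (h : IsGeneric P e a) :
    P.eval a ≠ 0 := by simpa using h 0 (Nat.zero_le e)

theorem exists_root_of_mul_neg {P : ℝ[X]} {a b : ℝ} (hab : a < b)
    (h : P.eval a * P.eval b < 0) : ∃ c ∈ Set.Ioo a b, P.eval c = 0 := by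
  rcases mul_neg_iff.1 h with ⟨h1, h2⟩ | ⟨h1, h2⟩
  · exact intermediate_value_Ioo' hab.le P.continuousOn ⟨h2, h1⟩
  · exact intermediate_value_Ioo hab.le P.continuousOn ⟨h1, h2⟩

theorem exists_derivative_mul_eq {P : ℝ[X]} {a b : ℝ} (hab : a < b) :
    ∃ c ∈ Set.Ioo a b, (derivative P).eval c * (b - a) = P.eval b - P.eval a := by
  obtain ⟨c, hc, h⟩ := exists_deriv_eq_slope (fun x => P.eval x) hab P.continuousOn
    P.differentiable.differentiableOn
  refine ⟨c, hc, ?_⟩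
  rw [Polynomial.deriv, eq_div_iff (sub_pos.2 hab).ne'] at h
  exact h

/-- `P` starts by moving away from zero but has to come back: by the mean value theorem `P'` takes
somewhere in between the sign opposite to `P(a)`, which is the sign opposite to `P'(a)`. -/
theorem exists_derivative_root_left {P : ℝ[X]} {a c : ℝ} (hac : a < c)
    (h : 0 < P.eval a * (derivative P).eval a) (hc : P.eval c = 0) :
    ∃ x ∈ Set.Ioo a c, (derivative P).eval x = 0 := by
  obtain ⟨y, hy, hy'⟩ := exists_derivative_mul_eq (P := P) hac
  have hpos : 0 < c - a := sub_pos.2 hac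
  have : (derivative P).eval a * (derivative P).eval y < 0 := by
    rw [show P.eval a = -((derivative P).eval y * (c - a)) by rw [hy', hc]; ring] at h
    by_contra hn
    nlinarith [mul_nonneg (not_lt.1 hn) hpos.le]
  obtain ⟨x, hx, hx'⟩ := exists_root_of_mul_neg hy.1 this
  exact ⟨x, ⟨hx.1, hx.2.trans hy.2⟩, hx'⟩

theorem exists_derivative_root_right {P : ℝ[X]} {c b : ℝ} (hcb : c < b)
    (h : P.eval b * (derivative P).eval b < 0) (hc : P.eval c = 0) :
    ∃ x ∈ Set.Ioo c b, (derivative P).eval x = 0 := by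
  obtain ⟨y, hy, hy'⟩ := exists_derivative_mul_eq (P := P) hcb
  have hpos : 0 < b - c := sub_pos.2 hcb
  have : (derivative P).eval y * (derivative P).eval b < 0 := by
    rw [show P.eval b = (derivative P).eval y * (b - c) by rw [hy', hc]; ring] at h
    by_contra hn
    nlinarith [mul_nonneg (not_lt.1 hn) hpos.le]
  obtain ⟨x, hx, hx'⟩ := exists_root_of_mul_neg hy.2 this
  exact ⟨x, ⟨hy.1.trans hx.1, hx.2⟩, hx'⟩

theorem derivative_iterate_ne_zero {P : ℝ[X]} {e : ℕ} {a : ℝ}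
    (h : (derivative^[e] P).eval a ≠ 0) {m : ℕ} (hm : m ≤ e) : derivative^[m] P ≠ 0 := by
  intro h0
  obtain ⟨t, rfl⟩ := Nat.exists_eq_add_of_le hm
  rw [add_comm, Function.iterate_add_apply, h0, iterate_derivative_zero] at h
  simp at h

/-- If `P⁽ᵉ⁾` is not the zero polynomial, neither is any earlier derivative, so each has finitely
many roots. -/
theorem finite_not_isGeneric {P : ℝ[X]} {e : ℕ} {a : ℝ} (h : (derivative^[e] P).eval a ≠ 0) :
    {x | ¬ IsGeneric P e x}.Finite := by
  have : {x | ¬ IsGeneric P e x} ⊆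
      ⋃ m ∈ Set.Iic e, {x | (derivative^[m] P).IsRoot x} := by
    intro x hx
    simp only [IsGeneric, Set.mem_ofPred_eq, not_forall, not_not] at hx
    obtain ⟨m, hm, hx⟩ := hx
    simp only [Set.mem_iUnion]
    exact ⟨m, hm, hx⟩
  refine Set.Finite.subset ((Set.finite_Iic e).biUnion fun m hm => ?_) this
  exact Polynomial.finite_setOfPred_isRoot (derivative_iterate_ne_zero h hm)

theorem exists_isGeneric {P : ℝ[X]} {e : ℕ} {a : ℝ} (h : (derivative^[e] P).eval a ≠ 0)
    {u v : ℝ} (huv : u < v) : ∃ x ∈ Set.Ioo u v, IsGeneric P e x := by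
  by_contra! hn
  exact Set.Ioo_infinite huv ((finite_not_isGeneric h).subset fun x hx => hn x hx)

/-- A weak form of the theorem of Budan and Fourier. -/
theorem signChanges_le_and_lt {P : ℝ[X]} {e : ℕ} {a b : ℝ} (hab : a < b)
    (ha : IsGeneric P e a) (hb : IsGeneric P e b)
    (he : ∀ x ∈ Set.Icc a b, (derivative^[e] P).eval x ≠ 0) :
    signChanges P e b ≤ signChanges P e a ∧
      ((∃ c ∈ Set.Ioo a b, P.eval c = 0) → signChanges P e b < signChanges P e a) := by
  induction e generalizing P a b with
  | zero =>
    refine ⟨by simp [signChanges], ?_⟩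
    rintro ⟨c, hc, h0⟩
    exact absurd h0 (by simpa using he c ⟨hc.1.le, hc.2.le⟩)
  | succ e ih =>
    simp only [signChanges_succ]
    have hD := ih hab ha.derivative hb.derivative (by simpa using he)
    have hPa := ha.eval_ne_zero
    have hPb := hb.eval_ne_zero
    have hQa := ha.derivative.eval_ne_zero
    have hQb := hb.derivative.eval_ne_zero
    -- The pair `(P, P')` contributes `0` or `1`, so a drop in the count for `P'` makes up for any
    -- increase. Strictness is in doubt only if the pair gains a sign change.
    rcases hD.1.lt_or_eq with hlt | heq
    · refine ⟨by split_ifs <;> omega, ?_⟩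
      rintro ⟨c, hc, h0⟩
      split_ifs with h1 h2
      · omega
      -- Here the pair gains a sign change although `P` has a root `c`. Then `P'` has a root on each
      -- side of `c`. Splitting at a generic point between these two roots shows that the count for
      -- `P'` drops at least twice.
      · have h2' := lt_of_le_of_ne (not_lt.1 h2) (mul_ne_zero hPa hQa).symm
        obtain ⟨x, hx, hx0⟩ := exists_derivative_root_left hc.1 h2' h0
        obtain ⟨y, hy, hy0⟩ := exists_derivative_root_right hc.2 h1 h0
        obtain ⟨z, hz, hzg⟩ := exists_isGeneric (P := derivative P) (e := e) (a := a)
          (ha.derivative e le_rfl) (hx.2.trans hy.1)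
        have haz := hx.1.trans hz.1
        have hzb := hz.2.trans hy.2
        have h3 := (ih haz ha.derivative hzg fun t ht => by
          simpa using he t ⟨ht.1, ht.2.trans hzb.le⟩).2 ⟨x, ⟨hx.1, hz.1⟩, hx0⟩
        have h4 := (ih hzb hzg hb.derivative fun t ht => by
          simpa using he t ⟨haz.le.trans ht.1, ht.2⟩).2 ⟨y, ⟨hz.2, hy.2⟩, hy0⟩
        omega
      · omega
      · omega
    -- Now `P'` has no root in `(a, b)`. A root of `P` forces the pair to lose its sign change;
    -- without one, neither `P` nor `P'` changes sign between `a` and `b`.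
    · have hnr : ∀ x ∈ Set.Ioo a b, (derivative P).eval x ≠ 0 := fun x hx h0 =>
        absurd (hD.2 ⟨x, hx, h0⟩) (by omega)
      have hS : (∃ c ∈ Set.Ioo a b, P.eval c = 0) →
          P.eval a * (derivative P).eval a < 0 ∧ ¬ P.eval b * (derivative P).eval b < 0 := by
        rintro ⟨c, hc, h0⟩
        constructor
        · by_contra h
          obtain ⟨x, hx, hx0⟩ := exists_derivative_root_left hc.1
            (lt_of_le_of_ne (not_lt.1 h) (mul_ne_zero hPa hQa).symm) h0
          exact hnr x ⟨hx.1, hx.2.trans hc.2⟩ hx0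
        · intro h
          obtain ⟨x, hx, hx0⟩ := exists_derivative_root_right hc.2 h h0
          exact hnr x ⟨hc.1.trans hx.1, hx.2⟩ hx0
      by_cases hr : ∃ c ∈ Set.Ioo a b, P.eval c = 0
      · obtain ⟨h1, h2⟩ := hS hr
        rw [if_pos h1, if_neg h2]
        exact ⟨by omega, fun _ => by omega⟩
      · refine ⟨?_, fun h => absurd h hr⟩
        have h1 : 0 < P.eval a * P.eval b := lt_of_le_of_ne
          (not_lt.1 fun h => hr (exists_root_of_mul_neg hab h)) (mul_ne_zero hPa hPb).symm
        have h2 : 0 < (derivative P).eval a * (derivative P).eval b := lt_of_le_of_ne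
          (not_lt.1 fun h => by
            obtain ⟨c, hc, h0⟩ := exists_root_of_mul_neg hab h
            exact hnr c hc h0) (mul_ne_zero hQa hQb).symm
        have h3 : P.eval b * (derivative P).eval b < 0 → P.eval a * (derivative P).eval a < 0 := by
          intro h
          by_contra hn
          nlinarith [mul_pos h1 h2, mul_nonneg (not_lt.1 hn) (neg_nonneg.2 h.le)]
        split_ifs with h4 h5
        · omega
        · exact absurd (h3 h4) h5
        · omega
        · omega

/-- Each root of `P` in `[0, 1]` is the threshold at which the number of sign changes drops
below `i + 1`, for some `i < e`. -/
theorem exists_threshold {P : ℝ[X]} {e : ℕ}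
    (he : ∀ x ∈ Set.Icc (-1 : ℝ) 1, (derivative^[e] P).eval x ≠ 0) {c : ℝ}
    (hc : c ∈ Set.Icc (0 : ℝ) 1) (h0 : P.eval c = 0) :
    ∃ i < e, ∀ a ∈ Set.Icc (0 : ℝ) 1, IsGeneric P e a →
      (i + 1 ≤ signChanges P e a ↔ a < c) := by
  classical
  -- Starting at `-1` leaves room for generic points to the left of `c` even when `c = 0`. The
  -- minimum of `S` will be `i + 1`.
  let S : ℕ → Prop := fun j => ∃ a ∈ Set.Ioo (-1 : ℝ) c, IsGeneric P e a ∧ signChanges P e a = j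
  have hS : ∃ j, S j := by
    obtain ⟨x, hx, hg⟩ := exists_isGeneric (he 0 (by norm_num)) (show (-1 : ℝ) < c by linarith [hc.1])
    exact ⟨_, x, hx, hg, rfl⟩
  obtain ⟨a, ha, hag, haj⟩ := Nat.find_spec hS
  have hlt : ∀ b, IsGeneric P e b → c < b →
      (∀ x ∈ Set.Icc (-1 : ℝ) b, (derivative^[e] P).eval x ≠ 0) →
      signChanges P e b < signChanges P e a := fun b hbg hcb hb =>
    (signChanges_le_and_lt (ha.2.trans hcb) hag hbg fun x hx =>
      hb x ⟨ha.1.le.trans hx.1, hx.2⟩).2 ⟨c, ⟨ha.2, hcb⟩, h0⟩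
  have hpos : 0 < signChanges P e a := by
    -- Positivity of the minimum needs a generic point to the right of `c`. Since `c` may be `1`,
    -- the region where `P⁽ᵉ⁾` does not vanish is extended beyond `1` by continuity.
    obtain ⟨ε, hε, hball⟩ := Metric.isOpen_iff.1
      (isOpen_ne_fun (derivative^[e] P).continuous continuous_const) 1
      (he 1 (by norm_num))
    obtain ⟨b, hb, hbg⟩ := exists_isGeneric (he 0 (by norm_num))
      (show (1 : ℝ) < 1 + ε by linarith)
    refine (Nat.zero_le _).trans_lt (hlt b hbg (hc.2.trans_lt hb.1) fun x hx => ?_)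
    rcases le_or_gt x 1 with hx1 | hx1
    · exact he x ⟨hx.1, hx1⟩
    · refine hball (Metric.mem_ball.2 ?_)
      rw [Real.dist_eq, abs_lt]
      constructor <;> linarith [hx.2, hb.2]
  refine ⟨signChanges P e a - 1, ?_, fun b hb hbg => ?_⟩
  · have := signChanges_le P e a
    omega
  · rw [Nat.sub_add_cancel hpos]
    constructor
    · intro h
      by_contra hn
      rcases (not_lt.1 hn).lt_or_eq with h' | h'
      · exact absurd (hlt b hbg h' fun x hx => he x ⟨hx.1, hx.2.trans hb.2⟩) (by omega)
      · exact hbg.eval_ne_zero (h' ▸ h0)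
    · intro h
      rw [haj]
      exact Nat.find_min' hS ⟨b, ⟨by linarith [hb.1], h⟩, hbg, rfl⟩

/-! ## A space-filling curve of Schoenberg type -/

/-! ### Tail bounds for geometric series with coefficients in `[0, 1]` -/

section GeometricSeries

variable {C r w : ℝ} {f : ℕ → ℝ}

theorem summable_geometric_mul (hr0 : 0 ≤ r) (hr1 : r < 1) (hw : 0 ≤ w)
    (hf0 : ∀ t, 0 ≤ f t) (hf1 : ∀ t, f t ≤ 1) : Summable fun t => w * r ^ t * f t :=
  Summable.of_nonneg_of_le
    (fun t => mul_nonneg (mul_nonneg hw (pow_nonneg hr0 t)) (hf0 t))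
    (fun t => mul_le_of_le_one_right (mul_nonneg hw (pow_nonneg hr0 t)) (hf1 t))
    ((summable_geometric_of_lt_one hr0 hr1).mul_left w)

theorem sum_le_tsum_geometric_mul (hr0 : 0 ≤ r) (hr1 : r < 1) (hw : 0 ≤ w)
    (hf0 : ∀ t, 0 ≤ f t) (hf1 : ∀ t, f t ≤ 1) (n : ℕ) :
    ∑ t ∈ Finset.range n, w * r ^ t * f t ≤ ∑' t, w * r ^ t * f t :=
  (summable_geometric_mul hr0 hr1 hw hf0 hf1).sum_le_tsum _ fun t _ =>
    mul_nonneg (mul_nonneg hw (pow_nonneg hr0 t)) (hf0 t)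

theorem tsum_geometric_mul_le (hr0 : 0 ≤ r) (hr1 : r < 1) (hC : 0 ≤ C) (hw : w = C * (1 - r))
    (hf0 : ∀ t, 0 ≤ f t) (hf1 : ∀ t, f t ≤ 1) (n : ℕ) :
    ∑' t, w * r ^ t * f t ≤ ∑ t ∈ Finset.range n, w * r ^ t * f t + C * r ^ n := by
  have hw0 : 0 ≤ w := hw ▸ mul_nonneg hC (sub_nonneg.2 hr1.le)
  have hs := summable_geometric_mul hr0 hr1 hw0 hf0 hf1
  rw [← hs.sum_add_tsum_nat_add n]
  gcongr
  have hg : Summable fun t => w * r ^ n * r ^ t :=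
    (summable_geometric_of_lt_one hr0 hr1).mul_left _
  calc ∑' t, w * r ^ (t + n) * f (t + n) ≤ ∑' t, w * r ^ n * r ^ t := by
        refine ((summable_nat_add_iff n).2 hs).tsum_le_tsum (fun t => ?_) hg
        refine (mul_le_of_le_one_right (mul_nonneg hw0 (pow_nonneg hr0 _)) (hf1 _)).trans_eq ?_
        rw [pow_add]
        ring
    _ = C * r ^ n := by
        rw [tsum_mul_left, tsum_geometric_of_lt_one hr0 hr1, hw]
        have : 1 - r ≠ 0 := (sub_pos.2 hr1).ne'
        field_simp

end GeometricSeries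

/-! ### A piecewise linear periodic function that reads one digit -/

section Zigzag

variable {K : Type*} [Field K] [LinearOrder K] [FloorRing K]

/-- A continuous function of period one which vanishes near the integers and is equal to one
at distance at least `1 / 3` from the integers. -/
def zigzag (t : K) : K := max (min (6 * |t - round t| - 1) 1) 0

theorem zigzag_nonneg (t : K) : 0 ≤ zigzag t := le_max_right _ _

theorem zigzag_le_one (t : K) : zigzag t ≤ 1 := max_le (min_le_right _ _) zero_le_one

variable [IsStrictOrderedRing K]

theorem abs_sub_round_sub_le (s t : K) : |s - round s| - |t - round t| ≤ |s - t| := by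
  have h1 := round_le s (round t)
  have h2 := abs_sub_le s t (round t : K)
  linarith

/-- The distance to the nearest integer is 1-Lipschitz, and clamping does not increase distances. -/
theorem abs_zigzag_sub_le (s t : K) : |zigzag s - zigzag t| ≤ 6 * |s - t| := by
  refine (abs_max_sub_max_le_abs _ _ _).trans ?_
  refine (abs_min_sub_min_le_max _ _ _ _).trans ?_
  rw [sub_self, abs_zero, max_eq_left (abs_nonneg _), abs_le]
  have h1 := abs_sub_round_sub_le s t
  have h2 := abs_sub_round_sub_le t s
  rw [abs_sub_comm t s] at h2
  constructor <;> linarith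

theorem zigzag_int_add {z : ℤ} {θ : K} (h0 : 0 ≤ θ) (h1 : θ ≤ 1 / 6) : zigzag (z + θ) = 0 := by
  have h := round_le ((z : K) + θ) z
  rw [add_sub_cancel_left, abs_of_nonneg h0] at h
  exact max_eq_right ((min_le_left _ _).trans (by linarith))

theorem zigzag_int_add_half_add {z : ℤ} {θ : K} (h0 : 0 ≤ θ) (h1 : θ ≤ 1 / 6) :
    zigzag (z + 1 / 2 + θ) = 1 := by
  have h : 1 / 3 ≤ |(z : K) + 1 / 2 + θ - round ((z : K) + 1 / 2 + θ)| := by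
    generalize round ((z : K) + 1 / 2 + θ) = n
    rcases le_or_gt n z with hn | hn
    · have : (n : K) ≤ z := Int.cast_le.2 hn
      exact le_trans (by linarith) (le_abs_self _)
    · have : (z : K) + 1 ≤ n := by exact_mod_cast hn
      exact le_trans (by linarith) (neg_le_abs _)
  rw [zigzag, min_eq_right (by linarith)]
  exact max_eq_left zero_le_one

theorem zigzag_ratCast (q : ℚ) : ((zigzag q : ℚ) : K) = zigzag (q : K) := by
  simp [zigzag, Rat.round_cast]

end Zigzag

/-- The `i`-th coordinate of a space-filling curve in dimension `N`. -/
noncomputable def curve (N i : ℕ) (x : ℝ) : ℝ :=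
  ∑' t, 1 / 3 * (2 / 3) ^ t * zigzag (4 ^ (N * t + i) * x)

/-- The partial sums of `curve`. -/
def curveSum (N i n : ℕ) (x : ℚ) : ℚ :=
  ∑ t ∈ Finset.range n, 1 / 3 * (2 / 3) ^ t * zigzag (4 ^ (N * t + i) * x)

/-- The sum of the first `n` terms of the expansion in base `3 / 2` with digits
`b i, b (N + i), b (2 * N + i), …`. -/
def digitSum (b : ℕ → ℕ) (N i n : ℕ) : ℚ :=
  ∑ t ∈ Finset.range n, 1 / 3 * (2 / 3) ^ t * (b (N * t + i) : ℚ)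

/-- The number with expansion `b i, b (N + i), b (2 * N + i), …` in base `3 / 2`. -/
noncomputable def digitLim (b : ℕ → ℕ) (N i : ℕ) : ℝ :=
  ∑' t, 1 / 3 * (2 / 3) ^ t * (b (N * t + i) : ℝ)

/-- The first `n` terms of `codeLim`. -/
def codeSum (b : ℕ → ℕ) (n : ℕ) : ℚ := ∑ t ∈ Finset.range n, 1 / 2 * (1 / 4) ^ t * (b t : ℚ)

/-- The embedding of Cantor space into the unit interval. -/
noncomputable def codeLim (b : ℕ → ℕ) : ℝ := ∑' t, 1 / 2 * (1 / 4) ^ t * (b t : ℝ)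

theorem curveSum_le (N i n : ℕ) (x : ℝ) :
    ∑ t ∈ Finset.range n, 1 / 3 * (2 / 3) ^ t * zigzag (4 ^ (N * t + i) * x) ≤ curve N i x :=
  sum_le_tsum_geometric_mul (by norm_num) (by norm_num) (by norm_num)
    (fun _ => zigzag_nonneg _) (fun _ => zigzag_le_one _) n

theorem curve_le (N i n : ℕ) (x : ℝ) :
    curve N i x ≤ ∑ t ∈ Finset.range n, 1 / 3 * (2 / 3) ^ t * zigzag (4 ^ (N * t + i) * x) +
      (2 / 3) ^ n :=
  (tsum_geometric_mul_le (C := 1) (by norm_num) (by norm_num) (by norm_num) (by norm_num)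
    (fun _ => zigzag_nonneg _) (fun _ => zigzag_le_one _) n).trans_eq (by rw [one_mul])

theorem curve_mem (N i : ℕ) (x : ℝ) : curve N i x ∈ Set.Icc (0 : ℝ) 1 :=
  ⟨by simpa using curveSum_le N i 0 x, by simpa using curve_le N i 0 x⟩

/-! ### Recovering digits from the coded point -/

section Digits

variable {b : ℕ → ℕ}

theorem digitSum_le_digitLim (hb : ∀ m, b m ≤ 1) (N i n : ℕ) : (digitSum b N i n : ℝ) ≤ digitLim b N i := by
  have := sum_le_tsum_geometric_mul (r := 2 / 3) (w := 1 / 3) (f := fun t => (b (N * t + i) : ℝ))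
    (by norm_num) (by norm_num) (by norm_num) (fun _ => Nat.cast_nonneg _)
    (fun _ => by exact_mod_cast hb _) n
  simpa [digitSum, digitLim] using this

theorem digitLim_le (hb : ∀ m, b m ≤ 1) (N i n : ℕ) : digitLim b N i ≤ digitSum b N i n + (2 / 3) ^ n := by
  have := tsum_geometric_mul_le (C := 1) (r := 2 / 3) (w := 1 / 3)
    (f := fun t => (b (N * t + i) : ℝ))
    (by norm_num) (by norm_num) (by norm_num) (by norm_num) (fun _ => Nat.cast_nonneg _)
    (fun _ => by exact_mod_cast hb _) n
  simpa [digitSum, digitLim] using this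

theorem codeSum_le_codeLim (hb : ∀ m, b m ≤ 1) (n : ℕ) : (codeSum b n : ℝ) ≤ codeLim b := by
  have := sum_le_tsum_geometric_mul (r := 1 / 4) (w := 1 / 2) (f := fun t => (b t : ℝ))
    (by norm_num) (by norm_num) (by norm_num) (fun _ => Nat.cast_nonneg _)
    (fun _ => by exact_mod_cast hb _) n
  simpa [codeSum, codeLim] using this

theorem codeLim_le (hb : ∀ m, b m ≤ 1) (n : ℕ) : codeLim b ≤ codeSum b n + 2 / 3 * (1 / 4) ^ n := by
  have := tsum_geometric_mul_le (C := 2 / 3) (r := 1 / 4) (w := 1 / 2) (f := fun t => (b t : ℝ))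
    (by norm_num) (by norm_num) (by norm_num) (by norm_num) (fun _ => Nat.cast_nonneg _)
    (fun _ => by exact_mod_cast hb _) n
  simpa [codeSum, codeLim] using this

theorem codeLim_mem (hb : ∀ m, b m ≤ 1) : codeLim b ∈ Set.Icc (0 : ℝ) 1 := by
  have h0 := codeSum_le_codeLim hb 0
  have h1 := codeLim_le hb 0
  simp only [codeSum, Finset.range_zero, Finset.sum_empty, Rat.cast_zero, pow_zero] at h0 h1
  exact ⟨h0, by linarith⟩

/-- Multiplication by `4 ^ m` turns the digits before `m` into an integer, digit `m` into `0` or `1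
/ 2`, and the tail into some `θ` in `[0, 1 / 6]`. On the two resulting arcs modulo one, `zigzag` is
constantly `0` and `1` respectively. -/
theorem zigzag_codeLim (hb : ∀ m, b m ≤ 1) (m : ℕ) : zigzag (4 ^ m * codeLim b) = (b m : ℝ) := by
  have hint : ∀ m, ∃ z : ℤ, (4 : ℝ) ^ m * codeSum b m = z := by
    intro m
    induction m with
    | zero => exact ⟨0, by simp [codeSum]⟩
    | succ m ih =>
      obtain ⟨z, hz⟩ := ih
      refine ⟨4 * z + 2 * b m, ?_⟩
      have h4 : (4 : ℝ) ^ m * (1 / 4) ^ m = 1 := by rw [← mul_pow]; norm_num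
      rw [codeSum, Finset.sum_range_succ, ← codeSum]
      push_cast
      rw [← hz]
      linear_combination (2 * (b m : ℝ)) * h4
  obtain ⟨z, hz⟩ := hint m
  have h4 : (4 : ℝ) ^ m * (1 / 4) ^ m = 1 := by rw [← mul_pow]; norm_num
  have hpos : (0 : ℝ) < 4 ^ m := by positivity
  have h0 := mul_le_mul_of_nonneg_left (codeSum_le_codeLim hb (m + 1)) hpos.le
  have h1 := mul_le_mul_of_nonneg_left (codeLim_le hb (m + 1)) hpos.le
  rw [codeSum, Finset.sum_range_succ, ← codeSum] at h0 h1
  push_cast at h0 h1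
  have e0 : (4 : ℝ) ^ m * (codeSum b m + 1 / 2 * (1 / 4) ^ m * b m) = z + 1 / 2 * b m := by
    rw [← hz]
    linear_combination (1 / 2 * (b m : ℝ)) * h4
  -- The tail bound `2 / 3 * (1 / 4) ^ (m + 1)`, scaled by `4 ^ m`, is exactly the `1 / 6` on which
  -- `zigzag` is flat.
  have e1 : (4 : ℝ) ^ m * (codeSum b m + 1 / 2 * (1 / 4) ^ m * b m + 2 / 3 * (1 / 4) ^ (m + 1)) =
      z + 1 / 2 * b m + 1 / 6 := by
    rw [← hz]
    linear_combination (1 / 2 * (b m : ℝ) + 1 / 6) * h4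
  rw [e0] at h0
  rw [e1] at h1
  obtain hbm | hbm : b m = 0 ∨ b m = 1 := by have := hb m; omega
  · rw [hbm, Nat.cast_zero] at h0 h1 ⊢
    rw [show (4 : ℝ) ^ m * codeLim b = z + (4 ^ m * codeLim b - z) by ring]
    exact zigzag_int_add (by linarith) (by linarith)
  · rw [hbm, Nat.cast_one] at h0 h1 ⊢
    rw [show (4 : ℝ) ^ m * codeLim b = z + 1 / 2 + (4 ^ m * codeLim b - z - 1 / 2) by ring]
    exact zigzag_int_add_half_add (by linarith) (by linarith)

theorem curve_codeLim (hb : ∀ m, b m ≤ 1) (N i : ℕ) : curve N i (codeLim b) = digitLim b N i := by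
  simp only [curve, digitLim, zigzag_codeLim hb]

end Digits

/-- Two errors add up: the weights sum to at most `1` and the frequencies that occur are at most `4
^ (N * n)`, which bounds the effect of replacing `x` by `r`; truncating the series costs `(2 / 3) ^
n`. -/
theorem abs_curveSum_sub_curve_le {N i : ℕ} (hi : i < N) (n : ℕ) {r : ℚ} {x ε : ℝ}
    (h : |(r : ℝ) - x| ≤ ε) :
    |(curveSum N i n r : ℝ) - curve N i x| ≤ 6 * 4 ^ (N * n) * ε + (2 / 3) ^ n := by
  have h1 := curveSum_le N i n x
  have h2 := curve_le N i n x
  have hε : 0 ≤ ε := (abs_nonneg _).trans h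
  have hw : ∑ t ∈ Finset.range n, (1 / 3 : ℝ) * (2 / 3) ^ t ≤ 1 := by
    rw [← Finset.mul_sum, geom_sum_eq (by norm_num)]
    have : (0 : ℝ) ≤ (2 / 3) ^ n := by positivity
    rw [show (1 / 3 : ℝ) * (((2 / 3) ^ n - 1) / (2 / 3 - 1)) = 1 - (2 / 3) ^ n by ring]
    linarith
  have h3 : |(curveSum N i n r : ℝ) -
      ∑ t ∈ Finset.range n, 1 / 3 * (2 / 3) ^ t * zigzag (4 ^ (N * t + i) * x)| ≤
      6 * 4 ^ (N * n) * ε := by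
    rw [curveSum]
    push_cast
    rw [← Finset.sum_sub_distrib]
    calc _ ≤ ∑ t ∈ Finset.range n, (1 / 3 : ℝ) * (2 / 3) ^ t * (6 * 4 ^ (N * n) * ε) := by
          refine (Finset.abs_sum_le_sum_abs _ _).trans (Finset.sum_le_sum fun t ht => ?_)
          rw [← mul_sub, abs_mul, abs_of_nonneg (by positivity : (0 : ℝ) ≤ 1 / 3 * (2 / 3) ^ t)]
          refine mul_le_mul_of_nonneg_left ?_ (by positivity)
          rw [zigzag_ratCast]
          refine (abs_zigzag_sub_le _ _).trans ?_
          push_cast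
          rw [← mul_sub, abs_mul, abs_of_nonneg (by positivity : (0 : ℝ) ≤ 4 ^ (N * t + i)),
            mul_assoc]
          have hle : N * t + i ≤ N * n := by
            have := Nat.mul_le_mul_left N (Finset.mem_range.1 ht : t + 1 ≤ n)
            rw [Nat.mul_succ] at this
            omega
          have : (4 : ℝ) ^ (N * t + i) ≤ 4 ^ (N * n) := pow_le_pow_right₀ (by norm_num) hle
          gcongr
      _ ≤ _ := by
          rw [← Finset.sum_mul]
          exact mul_le_of_le_one_left (by positivity) hw
  rw [abs_le] at h3 ⊢
  constructor <;> linarith [h3.1, h3.2]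

/-! ## Approximate evaluation of a polynomial and its derivatives -/

/-- `d` bounds the degree of `P`, and the coefficients of `P` are known up to `δ`. -/
def Approximates (c : ℕ → ℚ) (d : ℕ) (δ : ℝ) (P : ℝ[X]) : Prop :=
  P.natDegree ≤ d ∧ ∀ i ≤ d, |(c i : ℝ) - P.coeff i| < δ

/-- The value at `a` of the `m`-th derivative of `∑ i ≤ d, c i * X ^ i`. -/
def evalApprox (c : ℕ → ℚ) (d m : ℕ) (a : ℚ) : ℚ :=
  ∑ i ∈ Finset.range (d + 1), (i.descFactorial m : ℚ) * c i * a ^ (i - m)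

/-- A bound on the error of `evalApprox` on `[-1, 1]` when the coefficients have error `δ`. -/
def evalError (d m : ℕ) (δ : ℚ) : ℚ := ∑ i ∈ Finset.range (d + 1), (i.descFactorial m : ℚ) * δ

/-- A Lipschitz constant on `[-1, 1]` when the coefficients have error `δ`. -/
def lipBound (c : ℕ → ℚ) (d : ℕ) (δ : ℚ) : ℚ :=
  ∑ i ∈ Finset.range (d + 1), (i : ℚ) * (|c i| + δ)

/-- A certificate for the `e`-th derivative having no zero on `[-1, 1]`. -/
def LeadCert (c : ℕ → ℚ) (d e : ℕ) (δ : ℚ) : Prop :=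
  ∑ i ∈ Finset.range (d + 1), (if e < i then (i.descFactorial e : ℚ) * (|c i| + δ) else 0) <
    (e.descFactorial e : ℚ) * (|c e| - δ)

/-- The number of sign changes in the approximations of the derivatives of order up to `e`. -/
def signCount (c : ℕ → ℚ) (d e : ℕ) (a : ℚ) : ℕ :=
  ∑ m ∈ Finset.range e, if evalApprox c d m a * evalApprox c d (m + 1) a < 0 then 1 else 0

theorem eval_iterate_derivative {P : ℝ[X]} {d : ℕ} (h : P.natDegree ≤ d) (m : ℕ) (a : ℝ) :
    (derivative^[m] P).eval a =
      ∑ i ∈ Finset.range (d + 1), (i.descFactorial m : ℝ) * P.coeff i * a ^ (i - m) := by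
  conv_lhs => rw [P.as_sum_range_C_mul_X_pow' (Nat.lt_succ_of_le h)]
  rw [iterate_derivative_sum, eval_finsetSum]
  refine Finset.sum_congr rfl fun i _ => ?_
  rw [iterate_derivative_C_mul, iterate_derivative_X_pow_eq_natCast_mul]
  simp only [eval_mul, eval_C, eval_natCast, eval_pow, eval_X]
  ring

/-! ### Soundness of the certificates -/

namespace Approximates

variable {c : ℕ → ℚ} {d : ℕ} {δ : ℚ} {P : ℝ[X]}

theorem abs_evalApprox_sub_le (h : Approximates c d δ P) (m : ℕ) {a : ℚ} (ha : |a| ≤ 1) :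
    |(evalApprox c d m a : ℝ) - (derivative^[m] P).eval (a : ℝ)| ≤ evalError d m δ := by
  rw [eval_iterate_derivative h.1, evalApprox, evalError]
  push_cast
  rw [← Finset.sum_sub_distrib]
  refine (Finset.abs_sum_le_sum_abs _ _).trans (Finset.sum_le_sum fun i hi => ?_)
  rw [← sub_mul, ← mul_sub, abs_mul, abs_mul, Nat.abs_cast, abs_pow]
  have ha' : |(a : ℝ)| ≤ 1 := by exact_mod_cast ha
  refine (mul_le_of_le_one_right (by positivity) (pow_le_one₀ (abs_nonneg _) ha')).trans ?_
  exact mul_le_mul_of_nonneg_left (h.2 i (Nat.lt_succ_iff.1 (Finset.mem_range.1 hi))).le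
    (Nat.cast_nonneg _)

theorem isGeneric (h : Approximates c d δ P) {e : ℕ} {a : ℚ} (ha : |a| ≤ 1)
    (hg : ∀ m ≤ e, evalError d m δ < |evalApprox c d m a|) : IsGeneric P e a := by
  intro m hm h0
  have h1 := h.abs_evalApprox_sub_le m ha
  rw [h0, sub_zero] at h1
  exact absurd (hg m hm) (not_lt.2 (by exact_mod_cast h1))

/-- An approximate value that exceeds its error bound has the sign of the exact value. -/
theorem signCount_eq (h : Approximates c d δ P) {e : ℕ} {a : ℚ} (ha : |a| ≤ 1)
    (hg : ∀ m ≤ e, evalError d m δ < |evalApprox c d m a|) :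
    signCount c d e a = signChanges P e a := by
  have key : ∀ m ≤ e, 0 < (evalApprox c d m a : ℝ) * (derivative^[m] P).eval (a : ℝ) := by
    intro m hm
    have h1 := abs_le.1 (h.abs_evalApprox_sub_le m ha)
    have h2 : (evalError d m δ : ℝ) < |(evalApprox c d m a : ℝ)| := by exact_mod_cast hg m hm
    rcases lt_abs.1 h2 with h3 | h3
    · have h4 : 0 ≤ (evalError d m δ : ℝ) := by linarith [h1.1, h1.2]
      exact mul_pos (by linarith) (by linarith [h1.2])
    · have h4 : 0 ≤ (evalError d m δ : ℝ) := by linarith [h1.1, h1.2]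
      exact mul_pos_of_neg_of_neg (by linarith) (by linarith [h1.1])
  refine Finset.sum_congr rfl fun m hm => ?_
  have hm := Finset.mem_range.1 hm
  have k1 := key m hm.le
  have k2 := key (m + 1) hm
  have k3 := mul_pos k1 k2
  have e1 : (evalApprox c d m a * evalApprox c d (m + 1) a < 0) ↔
      (derivative^[m] P).eval (a : ℝ) * (derivative^[m + 1] P).eval (a : ℝ) < 0 := by
    rw [← Rat.cast_lt (K := ℝ)]
    push_cast
    constructor
    · intro h
      by_contra hn
      nlinarith [mul_nonneg (not_lt.1 hn) (neg_nonneg.2 h.le)]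
    · intro h
      by_contra hn
      nlinarith [mul_nonneg (not_lt.1 hn) (neg_nonneg.2 h.le)]
  simp only [e1]

/-- In `P⁽ᵉ⁾(x)` the terms of index below `e` vanish and the term of index `e` is constant; for `|x|
≤ 1` the certificate makes it larger than all higher terms together. -/
theorem eval_ne_zero_of_leadCert (h : Approximates c d δ P) {e : ℕ} (hed : e ≤ d)
    (hl : LeadCert c d e δ) {x : ℝ} (hx : x ∈ Set.Icc (-1 : ℝ) 1) :
    (derivative^[e] P).eval x ≠ 0 := by
  intro h0
  have hx' : |x| ≤ 1 := abs_le.2 hx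
  rw [eval_iterate_derivative h.1] at h0
  have hsplit : ∑ i ∈ Finset.range (d + 1), (i.descFactorial e : ℝ) * P.coeff i * x ^ (i - e) =
      (∑ i ∈ Finset.range (d + 1),
        if e < i then (i.descFactorial e : ℝ) * P.coeff i * x ^ (i - e) else 0) +
      (e.descFactorial e : ℝ) * P.coeff e := by
    rw [show (e.descFactorial e : ℝ) * P.coeff e = ∑ i ∈ Finset.range (d + 1),
        if i = e then (e.descFactorial e : ℝ) * P.coeff e else 0 by
      rw [Finset.sum_ite_eq' (Finset.range (d + 1)), if_pos (Finset.mem_range.2 (by omega))],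
      ← Finset.sum_add_distrib]
    refine Finset.sum_congr rfl fun i _ => ?_
    rcases lt_trichotomy i e with hi | rfl | hi
    · rw [Nat.descFactorial_of_lt hi, if_neg hi.not_gt, if_neg hi.ne]
      simp
    · simp
    · rw [if_pos hi, if_neg hi.ne']
      simp
  have hl' : ∑ i ∈ Finset.range (d + 1),
      (if e < i then (i.descFactorial e : ℝ) * (|(c i : ℝ)| + δ) else 0) <
      (e.descFactorial e : ℝ) * (|(c e : ℝ)| - δ) := by
    have := (Rat.cast_lt (K := ℝ)).2 hl
    push_cast [apply_ite (Rat.cast : ℚ → ℝ)] at this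
    exact this
  have h1 : |∑ i ∈ Finset.range (d + 1),
        if e < i then (i.descFactorial e : ℝ) * P.coeff i * x ^ (i - e) else 0| ≤
      ∑ i ∈ Finset.range (d + 1),
      (if e < i then (i.descFactorial e : ℝ) * (|(c i : ℝ)| + δ) else 0) := by
    refine (Finset.abs_sum_le_sum_abs _ _).trans (Finset.sum_le_sum fun i hi => ?_)
    split_ifs
    · rw [abs_mul, abs_mul, Nat.abs_cast, abs_pow]
      refine (mul_le_of_le_one_right (by positivity) (pow_le_one₀ (abs_nonneg _) hx')).trans ?_
      refine mul_le_mul_of_nonneg_left ?_ (Nat.cast_nonneg _)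
      have := h.2 i (Nat.lt_succ_iff.1 (Finset.mem_range.1 hi))
      have := abs_sub_abs_le_abs_sub (P.coeff i) (c i : ℝ)
      rw [abs_sub_comm] at this
      linarith
    · simp
  have h2 : (e.descFactorial e : ℝ) * (|(c e : ℝ)| - δ) ≤ |(e.descFactorial e : ℝ) * P.coeff e| := by
    rw [abs_mul, Nat.abs_cast]
    refine mul_le_mul_of_nonneg_left ?_ (Nat.cast_nonneg _)
    have := h.2 e hed
    have := abs_sub_abs_le_abs_sub (c e : ℝ) (P.coeff e)
    linarith
  rw [hsplit, add_eq_zero_iff_eq_neg] at h0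
  rw [h0, abs_neg] at h1
  linarith

/-- On `[-1, 1]` one has `|l ^ i - x ^ i| ≤ i * |l - x|`, so a zero within distance `w` of `l` would
force `|P(l)| ≤ w * lipBound c d δ`. -/
theorem eval_ne_zero_of_lipBound (h : Approximates c d δ P) {l w : ℚ} (hl : 0 ≤ l)
    (hlw : l + w ≤ 1) (hcert : evalError d 0 δ + w * lipBound c d δ < |evalApprox c d 0 l|)
    {x : ℝ} (hx : x ∈ Set.Icc (l : ℝ) (l + w)) : P.eval x ≠ 0 := by
  intro h0
  have hl' : (0 : ℝ) ≤ l := by exact_mod_cast hl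
  have hlw' : (l : ℝ) + w ≤ 1 := by exact_mod_cast hlw
  have hl1 : |l| ≤ 1 := by
    rw [abs_of_nonneg hl]
    have : (l : ℝ) ≤ 1 := by linarith [hx.1, hx.2]
    exact_mod_cast this
  have h1 := h.abs_evalApprox_sub_le 0 hl1
  have h2 : |P.eval (l : ℝ)| ≤ w * lipBound c d δ := by
    rw [← sub_zero (P.eval (l : ℝ)), ← h0]
    have e1 := eval_iterate_derivative h.1 0 (l : ℝ)
    have e2 := eval_iterate_derivative h.1 0 x
    simp only [Function.iterate_zero, id, Nat.descFactorial_zero, Nat.cast_one, one_mul,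
      Nat.sub_zero] at e1 e2
    rw [e1, e2, lipBound]
    push_cast
    rw [← Finset.sum_sub_distrib, Finset.mul_sum]
    refine (Finset.abs_sum_le_sum_abs _ _).trans (Finset.sum_le_sum fun i hi => ?_)
    rw [← mul_sub, abs_mul]
    have hc : |P.coeff i| ≤ |(c i : ℝ)| + δ := by
      have := h.2 i (Nat.lt_succ_iff.1 (Finset.mem_range.1 hi))
      have := abs_sub_abs_le_abs_sub (P.coeff i) (c i : ℝ)
      rw [abs_sub_comm] at this
      linarith
    have hp : |(l : ℝ) ^ i - x ^ i| ≤ w * i := by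
      refine (abs_pow_sub_pow_le _ _ _).trans ?_
      have hm : max |(l : ℝ)| |x| ≤ 1 := by
        rw [abs_of_nonneg hl', abs_of_nonneg (hl'.trans hx.1)]
        exact max_le (by linarith [hx.1, hx.2]) (hx.2.trans hlw')
      refine (mul_le_of_le_one_right (by positivity)
        (pow_le_one₀ ((abs_nonneg _).trans (le_max_left _ _)) hm)).trans ?_
      refine mul_le_mul_of_nonneg_right ?_ (Nat.cast_nonneg _)
      rw [abs_le]
      constructor <;> linarith [hx.1, hx.2]
    calc |P.coeff i| * |(l : ℝ) ^ i - x ^ i| ≤ (|(c i : ℝ)| + δ) * (w * i) :=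
          mul_le_mul hc hp (abs_nonneg _) ((abs_nonneg _).trans hc)
      _ = _ := by ring
  have h3 : (evalError d 0 δ : ℝ) + w * lipBound c d δ < |(evalApprox c d 0 l : ℝ)| := by
    exact_mod_cast hcert
  have h4 := abs_sub_abs_le_abs_sub (evalApprox c d 0 l : ℝ) (P.eval (l : ℝ))
  simp only [Function.iterate_zero, id] at h1
  linarith

end Approximates

/-! ### Completeness: certificates exist at sufficient precision -/

section Limits

open Filter Topology

variable {c : ℕ → ℕ → ℚ} {d : ℕ} {P : ℝ[X]}

theorem tendsto_half_pow : Tendsto (fun s : ℕ => (2⁻¹ : ℝ) ^ s) atTop (𝓝 0) :=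
  tendsto_pow_atTop_nhds_zero_of_lt_one (by norm_num) (by norm_num)

theorem tendsto_evalError (d m : ℕ) :
    Tendsto (fun s : ℕ => (evalError d m (2⁻¹ ^ s) : ℝ)) atTop (𝓝 0) := by
  have h : ∀ s : ℕ, (evalError d m (2⁻¹ ^ s) : ℝ) =
      (∑ i ∈ Finset.range (d + 1), (i.descFactorial m : ℝ)) * 2⁻¹ ^ s := fun s => by
    rw [evalError, Finset.sum_mul]
    push_cast
    rfl
  simp only [h]
  simpa using tendsto_half_pow.const_mul (∑ i ∈ Finset.range (d + 1), (i.descFactorial m : ℝ))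

theorem tendsto_coeff (hc : ∀ s, Approximates (c s) d ((2⁻¹ ^ s : ℚ) : ℝ) P) {i : ℕ} (hi : i ≤ d) :
    Tendsto (fun s => (c s i : ℝ)) atTop (𝓝 (P.coeff i)) :=
  tendsto_iff_dist_tendsto_zero.2 (squeeze_zero (fun _ => dist_nonneg)
    (fun s => ((hc s).2 i hi).le) (by simpa using tendsto_half_pow))

theorem exists_generic_cert (hc : ∀ s, Approximates (c s) d ((2⁻¹ ^ s : ℚ) : ℝ) P) {e : ℕ} {a : ℚ}
    (ha : |a| ≤ 1) (hg : IsGeneric P e a) :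
    ∃ s, ∀ m ≤ e, evalError d m (2⁻¹ ^ s) < |evalApprox (c s) d m a| := by
  have h : ∀ᶠ s in atTop, ∀ m ∈ Set.Iic e,
      evalError d m (2⁻¹ ^ s) < |evalApprox (c s) d m a| := by
    refine (Set.finite_Iic e).eventually_all.2 fun m hm => ?_
    have hpos := abs_pos.2 (hg m hm)
    filter_upwards [(tendsto_evalError d m).eventually_lt_const (half_pos hpos)] with s hs
    have h1 := (hc s).abs_evalApprox_sub_le m ha
    have h2 := abs_sub_abs_le_abs_sub ((derivative^[m] P).eval (a : ℝ)) (evalApprox (c s) d m a : ℝ)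
    rw [abs_sub_comm] at h2
    have h3 : (evalError d m (2⁻¹ ^ s) : ℝ) < |(evalApprox (c s) d m a : ℝ)| := by linarith
    exact_mod_cast h3
  exact h.exists

/-- The true degree works, since the approximations of the higher coefficients tend to zero. It
cannot be computed from a name, and the search may settle on another `e`. -/
theorem exists_leadCert (hc : ∀ s, Approximates (c s) d ((2⁻¹ ^ s : ℚ) : ℝ) P) (hP : P ≠ 0) :
    ∃ e ≤ d, ∃ s, LeadCert (c s) d e (2⁻¹ ^ s) := by
  have hed : P.natDegree ≤ d := (hc 0).1
  refine ⟨P.natDegree, hed, ?_⟩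
  set e := P.natDegree
  have hL : Tendsto (fun s : ℕ => ∑ i ∈ Finset.range (d + 1),
      (if e < i then (i.descFactorial e : ℝ) * (|(c s i : ℝ)| + 2⁻¹ ^ s) else 0))
      atTop (𝓝 (∑ i ∈ Finset.range (d + 1), 0)) := by
    refine tendsto_finsetSum _ fun i hi => ?_
    split_ifs with h
    · have h1 := ((tendsto_coeff hc (Nat.lt_succ_iff.1 (Finset.mem_range.1 hi))).abs.add
        tendsto_half_pow).const_mul (i.descFactorial e : ℝ)
      rw [coeff_eq_zero_of_natDegree_lt h] at h1
      simpa using h1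
    · exact tendsto_const_nhds
  have hR := ((tendsto_coeff hc hed).abs.sub tendsto_half_pow).const_mul (e.descFactorial e : ℝ)
  have hpos : ∑ i ∈ Finset.range (d + 1), (0 : ℝ) <
      (e.descFactorial e : ℝ) * (|P.coeff e| - 0) := by
    rw [Finset.sum_const_zero, sub_zero]
    refine mul_pos (Nat.cast_pos.2 (Nat.pos_of_ne_zero fun h => ?_))
      (abs_pos.2 (leadingCoeff_ne_zero.2 hP))
    exact absurd (Nat.descFactorial_eq_zero_iff_lt.1 h) (lt_irrefl _)
  obtain ⟨s, hs⟩ := (hL.eventually_lt hR hpos).exists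
  refine ⟨s, (Rat.cast_lt (K := ℝ)).1 ?_⟩
  push_cast [apply_ite (Rat.cast : ℚ → ℝ)]
  exact hs

/-- The precision `s` is fixed first; the Lipschitz bound is then a constant, and shrinking
intervals make its contribution negligible. Hence one `s` serves all late rounds, however far the
digits have advanced when it is tried. -/
theorem exists_lipBound_cert (hc : ∀ s, Approximates (c s) d ((2⁻¹ ^ s : ℚ) : ℝ) P)
    {l : ℕ → ℚ} (hl : ∀ n, |l n| ≤ 1) {y : ℝ} (hy : Tendsto (fun n => (l n : ℝ)) atTop (𝓝 y))
    (hP : P.eval y ≠ 0) :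
    ∃ s, ∀ᶠ n in atTop, evalError d 0 (2⁻¹ ^ s) + (2 / 3) ^ n * lipBound (c s) d (2⁻¹ ^ s) <
      |evalApprox (c s) d 0 (l n)| := by
  have hpos := abs_pos.2 hP
  obtain ⟨s, hs⟩ := ((tendsto_evalError d 0).eventually_lt_const
    (show 0 < |P.eval y| / 4 by linarith)).exists
  refine ⟨s, ?_⟩
  have h1 : Tendsto (fun n : ℕ => (2 / 3 : ℝ) ^ n * lipBound (c s) d (2⁻¹ ^ s)) atTop (𝓝 0) := by
    simpa using (tendsto_pow_atTop_nhds_zero_of_lt_one (r := (2 / 3 : ℝ)) (by norm_num)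
      (by norm_num)).mul_const (lipBound (c s) d (2⁻¹ ^ s) : ℝ)
  have h2 : Tendsto (fun n => |P.eval (l n : ℝ)|) atTop (𝓝 |P.eval y|) :=
    ((P.continuous.tendsto y).comp hy).abs
  filter_upwards [h1.eventually_lt_const (show 0 < |P.eval y| / 4 by linarith),
    h2.eventually_const_lt (show 3 * |P.eval y| / 4 < |P.eval y| by linarith)] with n h3 h4
  have h5 := (hc s).abs_evalApprox_sub_le 0 (hl n)
  simp only [Function.iterate_zero, id] at h5
  have h6 := abs_sub_abs_le_abs_sub (P.eval (l n : ℝ)) (evalApprox (c s) d 0 (l n) : ℝ)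
  rw [abs_sub_comm] at h6
  have h7 : (evalError d 0 (2⁻¹ ^ s) : ℝ) + (2 / 3) ^ n * lipBound (c s) d (2⁻¹ ^ s) <
      |(evalApprox (c s) d 0 (l n) : ℝ)| := by linarith
  refine (Rat.cast_lt (K := ℝ)).1 ?_
  push_cast
  exact h7

end Limits

/-! ## The search for certificates -/

/-- The degree bound in a prefix of a name of a polynomial. -/
def degBound (u : List ℕ) : ℕ := u.getD 0 0

/-- The `s`-th approximation of the `i`-th coefficient in a prefix of a name of a polynomial. -/
def coeffApprox (u : List ℕ) (s i : ℕ) : ℚ := ratOf (u.getD (Nat.pair i s + 1) 0)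

/-- The parameter that is tried at a stage. -/
def stageParam (u : List ℕ) : ℕ := u.length.unpair.1.unpair.1

/-- The precision that is used at a stage. -/
def stagePrec (u : List ℕ) : ℕ := u.length.unpair.1.unpair.2

/-- The prefix is long enough for the coefficients to be read with the precision of the stage. -/
def Readable (u : List ℕ) : Prop := Nat.pair (degBound u) (stagePrec u) + 1 < u.length

/-- The `j`-th digit in a state `e :: digits`. -/
def stateDigit (S : List ℕ) (j : ℕ) : ℕ := S.getD (j + 1) 0

/-- The candidate to which the next digit belongs. -/
def nextIndex (N : ℕ) (S : List ℕ) : ℕ := (S.length - 1) % N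

/-- The left end point of the current interval of the candidate `i`. -/
def leftEnd (N i n : ℕ) (S : List ℕ) : ℚ := digitSum (stateDigit S) N i n

/-- A point in the middle third of the current interval of the candidate `nextIndex N S`. -/
def testPoint (N : ℕ) (u S : List ℕ) : ℚ :=
  leftEnd N (nextIndex N S) ((S.length - 1) / N) S +
    (2 / 3) ^ ((S.length - 1) / N) * (1 / 3 + 1 / 3 * ((stageParam u : ℚ) + 1)⁻¹)

/-- The certificate found for a number `e` of derivatives. -/
def LeadFound (u : List ℕ) : Prop :=
  (stageParam u ≤ degBound u ∧ Readable u) ∧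
    LeadCert (coeffApprox u (stagePrec u)) (degBound u) (stageParam u) (2⁻¹ ^ stagePrec u)

/-- The certificate found for a test point to be generic. -/
def GenericFound (N : ℕ) (u S : List ℕ) : Prop :=
  Readable u ∧ ∀ m < S.getD 0 0 + 1, evalError (degBound u) m (2⁻¹ ^ stagePrec u) <
    |evalApprox (coeffApprox u (stagePrec u)) (degBound u) m (testPoint N u S)|

/-- The digit which is chosen at a generic test point. -/
def nextDigit (N : ℕ) (u S : List ℕ) : ℕ :=
  if nextIndex N S + 1 ≤
    signCount (coeffApprox u (stagePrec u)) (degBound u) (S.getD 0 0) (testPoint N u S)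
  then 1 else 0

open scoped Classical in
/-- One step of the computation: a state is `[]` as long as the polynomial may be zero, and
`e :: digits` from then on. -/
noncomputable def step (N : ℕ) (u S : List ℕ) : List ℕ :=
  if S.length = 0 then if LeadFound u then [stageParam u] else []
  else if GenericFound N u S then S ++ [nextDigit N u S] else S

/-- The state which is reached after reading a prefix. -/
noncomputable def state (N : ℕ) (u : List ℕ) : List ℕ :=
  u.length.rec [] fun n S => step N (u.take n) S

/-- The certificate found for the candidate `stageParam u` not to be a root. -/
def NonrootFound (N : ℕ) (u : List ℕ) : Prop :=
  (stageParam u < N ∧ Readable u) ∧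
    evalError (degBound u) 0 (2⁻¹ ^ stagePrec u) +
      (2 / 3) ^ (((state N u).length - 1) / N) *
        lipBound (coeffApprox u (stagePrec u)) (degBound u) (2⁻¹ ^ stagePrec u) <
      |evalApprox (coeffApprox u (stagePrec u)) (degBound u) 0
        (leftEnd N (stageParam u) (((state N u).length - 1) / N) (state N u))|

open scoped Classical in
/-- The candidate which is found not to be a root, increased by one; zero if there is none. -/
noncomputable def nonroot (N : ℕ) (u : List ℕ) : ℕ :=
  if NonrootFound N u then stageParam u + 1 else 0

open scoped Classical in
/-- The entry `nonroot N u`, suppressed once all candidates are known not to be roots. -/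
noncomputable def removal (N : ℕ) (u : List ℕ) : ℕ :=
  if ∃ j < N, ∀ t < u.length + 1, nonroot N (u.take t) ≠ j + 1 then nonroot N u else 0

/-- Left end points of the intervals removed from the unit interval. -/
noncomputable def removedLeft (N : ℕ) (u : List ℕ) : ℚ :=
  if u.length % 2 = 0 then -1
  else codeSum (stateDigit (state N u)) ((state N u).length - 1) +
    (1 / 4) ^ ((state N u).length - 1)

/-- Right end points of the intervals removed from the unit interval. -/
noncomputable def removedRight (N : ℕ) (u : List ℕ) : ℚ :=
  if u.length % 2 = 0 then codeSum (stateDigit (state N u)) ((state N u).length - 1) else 2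

/-- The index of the approximation of the argument used for the `n`-th approximation of `curve`. -/
def curvePrec (N n : ℕ) : ℕ := (4 * N + 4) * (n + 1)

/-- The `n`-th approximation of `curve N i x`, where `r` approximates `x`. -/
def curveApprox (N i n : ℕ) (r : ℚ) : ℚ := curveSum N i (2 * n + 2) (max (min r 1) 0)

/-! ### Primitive recursiveness -/

section Primrec

variable {α : Type*} [Primcodable α]

section Eval

variable {c : α → ℕ → ℚ} {d m e : α → ℕ} {a δ : α → ℚ}

theorem PrimrecRat.evalApprox (hc : PrimrecRat fun x : α × ℕ => c x.1 x.2) (hd : Primrec d)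
    (hm : Primrec m) (ha : PrimrecRat a) :
    PrimrecRat fun x => evalApprox (c x) (d x) (m x) (a x) :=
  PrimrecRat.sum (((PrimrecRat.natCast (primrec_descFactorial.comp Primrec.snd
    (hm.comp Primrec.fst))).mul hc).mul ((ha.comp Primrec.fst).pow
      (Primrec.nat_sub.comp Primrec.snd (hm.comp Primrec.fst)))) (Primrec.succ.comp hd)

theorem PrimrecRat.evalError (hd : Primrec d) (hm : Primrec m) (hδ : PrimrecRat δ) :
    PrimrecRat fun x => evalError (d x) (m x) (δ x) :=
  PrimrecRat.sum ((PrimrecRat.natCast (primrec_descFactorial.comp Primrec.snd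
    (hm.comp Primrec.fst))).mul (hδ.comp Primrec.fst)) (Primrec.succ.comp hd)

theorem PrimrecRat.lipBound (hc : PrimrecRat fun x : α × ℕ => c x.1 x.2) (hd : Primrec d)
    (hδ : PrimrecRat δ) : PrimrecRat fun x => lipBound (c x) (d x) (δ x) :=
  PrimrecRat.sum ((PrimrecRat.natCast Primrec.snd).mul (hc.abs.add (hδ.comp Primrec.fst)))
    (Primrec.succ.comp hd)

theorem primrecPred_leadCert (hc : PrimrecRat fun x : α × ℕ => c x.1 x.2) (hd : Primrec d)
    (he : Primrec e) (hδ : PrimrecRat δ) :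
    PrimrecPred fun x => LeadCert (c x) (d x) (e x) (δ x) := by
  refine PrimrecRat.lt (PrimrecRat.sum (PrimrecRat.ite
    (Primrec.nat_lt.comp (he.comp Primrec.fst) Primrec.snd)
    ((PrimrecRat.natCast (primrec_descFactorial.comp Primrec.snd (he.comp Primrec.fst))).mul
      (hc.abs.add (hδ.comp Primrec.fst))) (PrimrecRat.const 0)) (Primrec.succ.comp hd)) ?_
  exact (PrimrecRat.natCast (primrec_descFactorial.comp he he)).mul
    ((hc.comp (Primrec.pair Primrec.id he)).abs.sub hδ)

/-- The count is obtained as a rational sum of indicators, followed by a floor. -/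
theorem primrec_signCount (hc : PrimrecRat fun x : α × ℕ => c x.1 x.2) (hd : Primrec d)
    (he : Primrec e) (ha : PrimrecRat a) :
    Primrec fun x => signCount (c x) (d x) (e x) (a x) := by
  have hc' : PrimrecRat fun y : (α × ℕ) × ℕ => c y.1.1 y.2 :=
    hc.comp (Primrec.pair (Primrec.fst.comp Primrec.fst) Primrec.snd)
  have h : PrimrecRat fun x => ∑ m ∈ Finset.range (e x),
      if Weihrauch.evalApprox (c x) (d x) m (a x) *
        Weihrauch.evalApprox (c x) (d x) (m + 1) (a x) < 0 then (1 : ℚ) else 0 := by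
    refine PrimrecRat.sum (PrimrecRat.ite (PrimrecRat.lt (PrimrecRat.mul ?_ ?_)
      (PrimrecRat.const 0)) (PrimrecRat.const 1) (PrimrecRat.const 0)) he
    · exact PrimrecRat.evalApprox (c := fun x : α × ℕ => c x.1) hc' (hd.comp Primrec.fst)
        Primrec.snd (ha.comp Primrec.fst)
    · exact PrimrecRat.evalApprox (c := fun x : α × ℕ => c x.1) hc' (hd.comp Primrec.fst)
        (Primrec.succ.comp Primrec.snd) (ha.comp Primrec.fst)
  refine h.natFloor.of_eq fun x => ?_
  rw [← Nat.floor_natCast (R := ℚ) (signCount _ _ _ _), signCount]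
  push_cast
  rfl

end Eval

section Sums

variable {b : α → ℕ → ℕ} {i n : α → ℕ}

theorem PrimrecRat.digitSum (hb : Primrec₂ b) (N : ℕ) (hi : Primrec i) (hn : Primrec n) :
    PrimrecRat fun x => digitSum (b x) N (i x) (n x) :=
  PrimrecRat.sum (((PrimrecRat.const _).mul ((PrimrecRat.const _).pow Primrec.snd)).mul
    (PrimrecRat.natCast (hb.comp Primrec.fst (Primrec.nat_add.comp
      (Primrec.nat_mul.comp (Primrec.const N) Primrec.snd) (hi.comp Primrec.fst))))) hn

theorem PrimrecRat.codeSum (hb : Primrec₂ b) (hn : Primrec n) :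
    PrimrecRat fun x => codeSum (b x) (n x) :=
  PrimrecRat.sum (((PrimrecRat.const _).mul ((PrimrecRat.const _).pow Primrec.snd)).mul
    (PrimrecRat.natCast (hb.comp Primrec.fst Primrec.snd))) hn

theorem PrimrecRat.zigzag {f : α → ℚ} (hf : PrimrecRat f) (h0 : ∀ x, 0 ≤ f x) :
    PrimrecRat fun x => zigzag (f x) := by
  have hr : PrimrecRat fun x => ((round (f x) : ℤ) : ℚ) := by
    refine (PrimrecRat.natCast (hf.add (PrimrecRat.const (1 / 2))).natFloor).of_eq fun x => ?_
    rw [round_eq, natCast_floor_eq_intCast_floor (add_nonneg (h0 x) (by norm_num))]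
  exact ((((PrimrecRat.const 6).mul (hf.sub hr).abs).sub (PrimrecRat.const 1)).min
    (PrimrecRat.const 1)).max (PrimrecRat.const 0)

theorem PrimrecRat.curveApprox (N : ℕ) (hi : Primrec i) (hn : Primrec n) {r : α → ℚ}
    (hr : PrimrecRat r) : PrimrecRat fun x => curveApprox N (i x) (n x) (r x) := by
  refine PrimrecRat.sum (((PrimrecRat.const _).mul ((PrimrecRat.const _).pow Primrec.snd)).mul
    (PrimrecRat.zigzag (((PrimrecRat.const 4).pow (Primrec.nat_add.comp
      (Primrec.nat_mul.comp (Primrec.const N) Primrec.snd) (hi.comp Primrec.fst))).mul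
      (((hr.comp Primrec.fst).min (PrimrecRat.const 1)).max (PrimrecRat.const 0))) fun x => ?_))
    (Primrec.nat_add.comp (Primrec.nat_mul.comp (Primrec.const 2) hn) (Primrec.const 2))
  exact mul_nonneg (by positivity) (le_max_right _ _)

end Sums

theorem primrec_degBound : Primrec degBound :=
  (Primrec.list_getD 0).comp Primrec.id (Primrec.const 0)

theorem primrec_stageParam : Primrec stageParam :=
  Primrec.fst.comp (Primrec.unpair.comp (Primrec.fst.comp
    (Primrec.unpair.comp Primrec.list_length)))

theorem primrec_stagePrec : Primrec stagePrec :=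
  Primrec.snd.comp (Primrec.unpair.comp (Primrec.fst.comp
    (Primrec.unpair.comp Primrec.list_length)))

theorem primrecRat_coeffApprox {u : α → List ℕ} (hu : Primrec u) :
    PrimrecRat fun x : α × ℕ => coeffApprox (u x.1) (stagePrec (u x.1)) x.2 :=
  PrimrecRat.ratOf ((Primrec.list_getD 0).comp (hu.comp Primrec.fst) (Primrec.succ.comp
    (Primrec₂.natPair.comp Primrec.snd ((primrec_stagePrec.comp hu).comp Primrec.fst))))

theorem primrecRat_tolerance : PrimrecRat fun u => (2⁻¹ : ℚ) ^ stagePrec u :=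
  (PrimrecRat.const _).pow primrec_stagePrec

theorem primrecPred_readable : PrimrecPred Readable :=
  Primrec.nat_lt.comp (Primrec.succ.comp (Primrec₂.natPair.comp primrec_degBound
    primrec_stagePrec)) Primrec.list_length

theorem primrec_stateDigit : Primrec₂ stateDigit :=
  (Primrec.list_getD 0).comp Primrec.fst (Primrec.succ.comp Primrec.snd)

theorem primrec_length_sub_one : Primrec fun S : List ℕ => S.length - 1 :=
  Primrec.nat_sub.comp Primrec.list_length (Primrec.const 1)

theorem primrec_rounds (N : ℕ) : Primrec fun S : List ℕ => (S.length - 1) / N :=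
  Primrec.nat_div.comp primrec_length_sub_one (Primrec.const N)

theorem primrec_nextIndex (N : ℕ) : Primrec (nextIndex N) :=
  Primrec.nat_mod.comp primrec_length_sub_one (Primrec.const N)

theorem PrimrecRat.leftEnd (N : ℕ) {i n : α → ℕ} {S : α → List ℕ} (hi : Primrec i)
    (hn : Primrec n) (hS : Primrec S) : PrimrecRat fun x => leftEnd N (i x) (n x) (S x) :=
  PrimrecRat.digitSum (b := fun x => stateDigit (S x))
    (primrec_stateDigit.comp (hS.comp Primrec.fst) Primrec.snd) N hi hn

theorem primrecRat_testPoint (N : ℕ) :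
    PrimrecRat fun x : List ℕ × List ℕ => testPoint N x.1 x.2 := by
  unfold testPoint
  exact (PrimrecRat.leftEnd N ((primrec_nextIndex N).comp Primrec.snd)
    ((primrec_rounds N).comp Primrec.snd) Primrec.snd).add
    (((PrimrecRat.const _).pow ((primrec_rounds N).comp Primrec.snd)).mul
      ((PrimrecRat.const _).add ((PrimrecRat.const _).mul
        (PrimrecRat.inv_succ (primrec_stageParam.comp Primrec.fst)))))

theorem primrecPred_leadFound : PrimrecPred LeadFound := by
  have h := primrecPred_leadCert (c := fun u => coeffApprox u (stagePrec u))
    (primrecRat_coeffApprox (u := fun u => u) Primrec.id) primrec_degBound primrec_stageParam primrecRat_tolerance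
  have h' : PrimrecPred fun u => stageParam u ≤ degBound u :=
    Primrec.nat_le.comp primrec_stageParam primrec_degBound
  exact (h'.and primrecPred_readable).and h

theorem primrecPred_genericFound (N : ℕ) :
    PrimrecPred fun x : List ℕ × List ℕ => GenericFound N x.1 x.2 := by
  have hu : Primrec fun y : ℕ × List ℕ × List ℕ => y.2.1 := Primrec.fst.comp Primrec.snd
  have h1 := PrimrecRat.evalError (primrec_degBound.comp hu) Primrec.fst
    (primrecRat_tolerance.comp hu)
  have h2 := PrimrecRat.abs (PrimrecRat.evalApprox (c := fun y : ℕ × List ℕ × List ℕ =>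
    coeffApprox y.2.1 (stagePrec y.2.1)) (primrecRat_coeffApprox (u := fun y : ℕ × List ℕ × List ℕ => y.2.1) hu)
    (primrec_degBound.comp hu) Primrec.fst ((primrecRat_testPoint N).comp Primrec.snd))
  have h : PrimrecRel fun (m : ℕ) (x : List ℕ × List ℕ) =>
      evalError (degBound x.1) m (2⁻¹ ^ stagePrec x.1) <
        |evalApprox (coeffApprox x.1 (stagePrec x.1)) (degBound x.1) m (testPoint N x.1 x.2)| :=
    h1.lt h2
  have he : Primrec fun x : List ℕ × List ℕ => x.2.getD 0 0 + 1 :=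
    Primrec.succ.comp ((Primrec.list_getD 0).comp Primrec.snd (Primrec.const 0))
  exact (primrecPred_readable.comp Primrec.fst).and (primrecPred_forall_lt h he)

theorem primrec_nextDigit (N : ℕ) :
    Primrec fun x : List ℕ × List ℕ => nextDigit N x.1 x.2 :=
  Primrec.ite (Primrec.nat_le.comp
    (Primrec.succ.comp ((primrec_nextIndex N).comp Primrec.snd))
    (primrec_signCount (c := fun x : List ℕ × List ℕ => coeffApprox x.1 (stagePrec x.1))
      (primrecRat_coeffApprox (u := fun x : List ℕ × List ℕ => x.1) Primrec.fst) (primrec_degBound.comp Primrec.fst)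
      ((Primrec.list_getD 0).comp Primrec.snd (Primrec.const 0)) (primrecRat_testPoint N)))
    (Primrec.const 1) (Primrec.const 0)

theorem primrec_step (N : ℕ) : Primrec₂ (step N) := by
  classical
  refine Primrec.ite (Primrec.eq.comp (Primrec.list_length.comp Primrec.snd) (Primrec.const 0))
    (Primrec.ite (primrecPred_leadFound.comp Primrec.fst)
      (Primrec.list_cons.comp (primrec_stageParam.comp Primrec.fst) (Primrec.const []))
      (Primrec.const []))
    (Primrec.ite (primrecPred_genericFound N) ?_ Primrec.snd)
  exact Primrec.list_concat.comp Primrec.snd (primrec_nextDigit N)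

theorem primrec_state (N : ℕ) : Primrec (state N) :=
  Primrec.nat_rec' Primrec.list_length (Primrec.const []) ((primrec_step N).comp
    (Primrec.list_take.comp (Primrec.fst.comp Primrec.snd) Primrec.fst)
    (Primrec.snd.comp Primrec.snd)).to₂

theorem primrec_state_rounds (N : ℕ) :
    Primrec fun u => ((state N u).length - 1) / N :=
  (primrec_rounds N).comp (primrec_state N)

theorem primrecPred_nonrootFound (N : ℕ) : PrimrecPred (NonrootFound N) := by
  have h1 := PrimrecRat.evalError primrec_degBound (Primrec.const 0) primrecRat_tolerance
  have h2 := PrimrecRat.lipBound (c := fun u => coeffApprox u (stagePrec u))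
    (primrecRat_coeffApprox (u := fun u => u) Primrec.id) primrec_degBound primrecRat_tolerance
  have h3 := (PrimrecRat.const (2 / 3)).pow (primrec_state_rounds N)
  have h4 := PrimrecRat.evalApprox (c := fun u => coeffApprox u (stagePrec u))
    (primrecRat_coeffApprox (u := fun u => u) Primrec.id) primrec_degBound (Primrec.const 0)
    (PrimrecRat.leftEnd N primrec_stageParam (primrec_state_rounds N) (primrec_state N))
  have h5 : PrimrecPred fun u => stageParam u < N :=
    Primrec.nat_lt.comp primrec_stageParam (Primrec.const N)
  exact (h5.and primrecPred_readable).and ((h1.add (h3.mul h2)).lt h4.abs)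

theorem primrec_nonroot (N : ℕ) : Primrec (nonroot N) := by
  classical
  exact Primrec.ite (primrecPred_nonrootFound N) (Primrec.succ.comp primrec_stageParam)
    (Primrec.const 0)

theorem primrec_removal (N : ℕ) : Primrec (removal N) := by
  classical
  refine Primrec.ite ?_ (primrec_nonroot N) (Primrec.const 0)
  have h1 : PrimrecRel fun (t : ℕ) (x : ℕ × List ℕ) => nonroot N (x.2.take t) ≠ x.1 + 1 :=
    (Primrec.eq.comp ((primrec_nonroot N).comp (Primrec.list_take.comp Primrec.fst
      (Primrec.snd.comp Primrec.snd))) (Primrec.succ.comp (Primrec.fst.comp Primrec.snd))).not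
  have h2 : PrimrecRel fun (j : ℕ) (u : List ℕ) =>
      ∀ t < u.length + 1, nonroot N (u.take t) ≠ j + 1 :=
    PrimrecPred.primrecRel (primrecPred_forall_lt h1
      (Primrec.succ.comp (Primrec.list_length.comp Primrec.snd)))
  exact primrecPred_exists_lt h2 (Primrec.const N)

theorem primrecPred_length_even : PrimrecPred fun u : List ℕ => u.length % 2 = 0 :=
  Primrec.eq.comp (Primrec.nat_mod.comp Primrec.list_length (Primrec.const 2)) (Primrec.const 0)

theorem primrecRat_codeSum_state (N : ℕ) :
    PrimrecRat fun u => codeSum (stateDigit (state N u)) ((state N u).length - 1) :=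
  PrimrecRat.codeSum (b := fun u => stateDigit (state N u))
    (primrec_stateDigit.comp ((primrec_state N).comp Primrec.fst) Primrec.snd)
    (primrec_length_sub_one.comp (primrec_state N))

theorem primrecRat_removedLeft (N : ℕ) : PrimrecRat (removedLeft N) :=
  PrimrecRat.ite primrecPred_length_even (PrimrecRat.const _)
    ((primrecRat_codeSum_state N).add ((PrimrecRat.const _).pow
      (primrec_length_sub_one.comp (primrec_state N))))

theorem primrecRat_removedRight (N : ℕ) : PrimrecRat (removedRight N) :=
  PrimrecRat.ite primrecPred_length_even (primrecRat_codeSum_state N) (PrimrecRat.const _)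

end Primrec

/-! ### Growing lists -/

theorem getD_eq_of_prefix {u v : List ℕ} (h : u <+: v) {i : ℕ} (hi : i < u.length) :
    v.getD i 0 = u.getD i 0 := by
  obtain ⟨w, rfl⟩ := h
  rw [List.getD_append _ _ _ _ hi]

/-- Prefix-increasing lists of unbounded length have a limit sequence. As they grow by at most one
entry at a time, no length is skipped: look at the first time the length exceeds `m`. -/
theorem exists_limit_of_growing {σ : ℕ → List ℕ} (h0 : σ 0 = [])
    (hstep : ∀ n, σ (n + 1) = σ n ∨ ∃ a, σ (n + 1) = σ n ++ [a])
    (hgrow : ∀ n, ∃ n' ≥ n, σ n' ≠ σ n) :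
    ∃ β : ℕ → ℕ, (∀ n, σ n = take β (σ n).length) ∧
      ∀ m, ∃ n, (σ n).length = m ∧ (σ (n + 1)).length = m + 1 := by
  have hpre : ∀ n n', n ≤ n' → σ n <+: σ n' := by
    intro n n' h
    induction h with
    | refl => exact List.prefix_rfl
    | step _ ih =>
      refine ih.trans ?_
      rcases hstep _ with h | ⟨a, h⟩
      · rw [h]
      · rw [h]
        exact List.prefix_append _ _
  have hunb : ∀ m, ∃ n, m ≤ (σ n).length := by
    intro m
    induction m with
    | zero => exact ⟨0, Nat.zero_le _⟩
    | succ m ih =>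
      obtain ⟨n, hn⟩ := ih
      obtain ⟨n', hn', hne⟩ := hgrow n
      refine ⟨n', hn.trans_lt (lt_of_le_of_ne (hpre n n' hn').length_le fun h => ?_)⟩
      exact hne ((hpre n n' hn').eq_of_length h).symm
  choose ν hν using fun m => hunb (m + 1)
  refine ⟨fun m => (σ (ν m)).getD m 0, fun n => ?_, fun m => ?_⟩
  · refine List.ext_getElem (by simp [take]) fun i hi _ => ?_
    have e : (σ n).getD i 0 = (σ (ν i)).getD i 0 := by
      rcases le_total n (ν i) with h | h
      · exact (getD_eq_of_prefix (hpre _ _ h) hi).symm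
      · exact getD_eq_of_prefix (hpre _ _ h) (hν i)
    rw [← List.getD_eq_getElem (d := 0), e]
    simp [take]
  · classical
    have hex : ∃ n, m + 1 ≤ (σ n).length := hunb (m + 1)
    rcases hn : Nat.find hex with _ | n
    · have := Nat.find_spec hex
      rw [hn, h0] at this
      simp at this
    · have h1 := Nat.find_spec hex
      have h2 := Nat.find_min hex (m := n) (by omega)
      rw [hn] at h1
      refine ⟨n, ?_⟩
      rcases hstep n with h | ⟨a, h⟩
      · rw [h] at h1
        exact absurd h1 h2
      · rw [h, List.length_append, List.length_singleton] at h1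
        rw [h, List.length_append, List.length_singleton]
        omega

/-! ### Correctness of the search -/

/-- Coefficients read from a finite prefix are known to agree with those of the name only up to the
degree bound. This lemma and the next three show that nothing beyond it matters. -/
theorem Approximates.congr {c c' : ℕ → ℚ} {d : ℕ} {δ : ℝ} {P : ℝ[X]} (h : Approximates c d δ P)
    (hc : ∀ i ≤ d, c' i = c i) : Approximates c' d δ P :=
  ⟨h.1, fun i hi => by rw [hc i hi]; exact h.2 i hi⟩

theorem evalApprox_congr {c c' : ℕ → ℚ} {d : ℕ} (hc : ∀ i ≤ d, c' i = c i) (m : ℕ) (a : ℚ) :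
    evalApprox c' d m a = evalApprox c d m a :=
  Finset.sum_congr rfl fun i hi => by rw [hc i (Nat.lt_succ_iff.1 (Finset.mem_range.1 hi))]

theorem lipBound_congr {c c' : ℕ → ℚ} {d : ℕ} (hc : ∀ i ≤ d, c' i = c i) (δ : ℚ) :
    lipBound c' d δ = lipBound c d δ :=
  Finset.sum_congr rfl fun i hi => by rw [hc i (Nat.lt_succ_iff.1 (Finset.mem_range.1 hi))]

theorem leadCert_congr {c c' : ℕ → ℚ} {d e : ℕ} (hc : ∀ i ≤ d, c' i = c i) (he : e ≤ d) (δ : ℚ) :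
    LeadCert c' d e δ ↔ LeadCert c d e δ := by
  rw [LeadCert, LeadCert, hc e he]
  refine iff_of_eq (congrArg (· < _) (Finset.sum_congr rfl fun i hi => ?_))
  rw [hc i (Nat.lt_succ_iff.1 (Finset.mem_range.1 hi))]

theorem digitSum_congr {b b' : ℕ → ℕ} {N i n : ℕ} (h : ∀ t < n, b (N * t + i) = b' (N * t + i)) :
    digitSum b N i n = digitSum b' N i n :=
  Finset.sum_congr rfl fun t ht => by rw [h t (Finset.mem_range.1 ht)]

theorem codeSum_congr {b b' : ℕ → ℕ} {n : ℕ} (h : ∀ t < n, b t = b' t) :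
    codeSum b n = codeSum b' n :=
  Finset.sum_congr rfl fun t ht => by rw [h t (Finset.mem_range.1 ht)]

theorem digitSum_succ (b : ℕ → ℕ) (N i n : ℕ) :
    digitSum b N i (n + 1) = digitSum b N i n + 1 / 3 * (2 / 3) ^ n * b (N * n + i) :=
  Finset.sum_range_succ _ _

theorem digitSum_nonneg (b : ℕ → ℕ) (N i n : ℕ) : 0 ≤ digitSum b N i n :=
  Finset.sum_nonneg fun _ _ => by positivity

/-- The intervals `[digitSum, digitSum + (2 / 3) ^ n]` are nested, starting from `[0, 1]`. -/
theorem digitSum_add_le_one {b : ℕ → ℕ} (hb : ∀ m, b m ≤ 1) (N i n : ℕ) :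
    digitSum b N i n + (2 / 3) ^ n ≤ 1 := by
  induction n with
  | zero => simp [digitSum]
  | succ n ih =>
    rw [digitSum_succ, pow_succ]
    have h1 : (b (N * n + i) : ℚ) ≤ 1 := by exact_mod_cast hb _
    have h2 : (0 : ℚ) ≤ (2 / 3) ^ n := by positivity
    nlinarith [mul_le_mul_of_nonneg_left h1 h2]

theorem stateDigit_step_le_one {N : ℕ} {u S : List ℕ} (h : ∀ j, stateDigit S j ≤ 1) (j : ℕ) :
    stateDigit (step N u S) j ≤ 1 := by
  rw [step]
  split_ifs with h1 h2 h3
  · simp [stateDigit]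
  · simp [stateDigit]
  · rw [stateDigit]
    rcases lt_or_ge (j + 1) S.length with hj | hj
    · rw [List.getD_append _ _ _ _ hj]
      exact h j
    · rw [List.getD_append_right _ _ _ _ hj]
      have : nextDigit N u S ≤ 1 := by
        rw [nextDigit]
        split_ifs <;> simp
      rcases (j + 1 - S.length) with _ | t <;> simp [this]
  · exact h j

theorem step_eq_or (N : ℕ) (u S : List ℕ) : step N u S = S ∨ ∃ a, step N u S = S ++ [a] := by
  rw [step]
  split_ifs with h1 h2 h3
  · exact Or.inr ⟨_, by rw [List.length_eq_zero_iff.1 h1]; rfl⟩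
  · exact Or.inl (List.length_eq_zero_iff.1 h1).symm
  · exact Or.inr ⟨_, rfl⟩
  · exact Or.inl rfl

theorem state_zero (N : ℕ) (p : ℕ → ℕ) : state N (take p 0) = [] := rfl

/-- `state` reruns the whole computation on its input, and earlier stages of the run see only
initial segments of that input. -/
theorem state_succ (N : ℕ) (p : ℕ → ℕ) (n : ℕ) :
    state N (take p (n + 1)) = step N (take p n) (state N (take p n)) := by
  have h : ∀ m j : ℕ, j ≤ m → (j.rec [] fun n S => step N ((take p m).take n) S : List ℕ) =
      j.rec [] fun n S => step N (take p n) S := by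
    intro m j
    induction j with
    | zero => exact fun _ => rfl
    | succ j ih =>
      intro hj
      dsimp only
      rw [ih (by omega), take_take p (by omega)]
  rw [state, take_length, h (n + 1) (n + 1) le_rfl, state, take_length, h n n le_rfl]

theorem stateDigit_state_le_one (N : ℕ) (p : ℕ → ℕ) (n j : ℕ) :
    stateDigit (state N (take p n)) j ≤ 1 := by
  induction n generalizing j with
  | zero => simp [state_zero, stateDigit]
  | succ n ih =>
    rw [state_succ]
    exact stateDigit_step_le_one ih j

theorem testPoint_mem (N : ℕ) (u S : List ℕ) :
    testPoint N u S ∈ Set.Icc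
      (leftEnd N (nextIndex N S) ((S.length - 1) / N) S + 1 / 3 * (2 / 3) ^ ((S.length - 1) / N))
      (leftEnd N (nextIndex N S) ((S.length - 1) / N) S +
        2 / 3 * (2 / 3) ^ ((S.length - 1) / N)) := by
  have h0 : (0 : ℚ) ≤ (2 / 3) ^ ((S.length - 1) / N) := by positivity
  have h1 : (0 : ℚ) ≤ ((stageParam u : ℚ) + 1)⁻¹ := by positivity
  have h2 : ((stageParam u : ℚ) + 1)⁻¹ ≤ 1 := inv_le_one_of_one_le₀ (by simp)
  rw [testPoint]
  constructor <;> nlinarith [mul_nonneg h0 h1, mul_le_mul_of_nonneg_left h2 h0]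

theorem testPoint_mem_unit {N : ℕ} {S : List ℕ} (hS : ∀ j, stateDigit S j ≤ 1) (u : List ℕ) :
    testPoint N u S ∈ Set.Icc (0 : ℚ) 1 := by
  have h := testPoint_mem N u S
  have h0 : (0 : ℚ) ≤ (2 / 3) ^ ((S.length - 1) / N) := by positivity
  have h1 := digitSum_nonneg (stateDigit S) N (nextIndex N S) ((S.length - 1) / N)
  have h2 := digitSum_add_le_one hS N (nextIndex N S) ((S.length - 1) / N)
  simp only [leftEnd] at h
  exact ⟨by linarith [h.1], by linarith [h.2]⟩

theorem abs_testPoint_le {N : ℕ} {S : List ℕ} (hS : ∀ j, stateDigit S j ≤ 1) (u : List ℕ) :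
    |testPoint N u S| ≤ 1 := by
  have h := testPoint_mem_unit (N := N) hS u
  rw [abs_of_nonneg h.1]
  exact h.2

/-! ### The search makes progress on every nonzero polynomial -/

section Search

variable {p : ℕ → ℕ} {P : ℝ[X]}

theorem degBound_take {n : ℕ} (hn : 0 < n) : degBound (take p n) = p 0 := take_getD p hn

theorem Readable.pos {n : ℕ} (h : Readable (take p n)) : 0 < n := by
  rw [Readable, take_length] at h
  omega

theorem coeffApprox_take {n i : ℕ} (h : Readable (take p n)) (hi : i ≤ p 0) :
    coeffApprox (take p n) (stagePrec (take p n)) i =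
      ratOf (p (Nat.pair i (stagePrec (take p n)) + 1)) := by
  rw [coeffApprox, take_getD]
  have h' := h
  rw [Readable, degBound_take h.pos, take_length] at h'
  have : Nat.pair i (stagePrec (take p n)) ≤ Nat.pair (p 0) (stagePrec (take p n)) := by
    rcases hi.lt_or_eq with h | h
    · exact (Nat.pair_lt_pair_left _ h).le
    · rw [h]
  omega

/-- The second component of the stage number is padding. It makes every pair of parameter and
precision recur arbitrarily late, after enough of the name has been read. -/
theorem exists_stage (p : ℕ → ℕ) (n₀ τ s : ℕ) : ∃ n ≥ n₀, stageParam (take p n) = τ ∧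
    stagePrec (take p n) = s ∧ Readable (take p n) := by
  have hle := Nat.right_le_pair (Nat.pair τ s) (n₀ + Nat.pair (p 0) s + 2)
  refine ⟨Nat.pair (Nat.pair τ s) (n₀ + Nat.pair (p 0) s + 2), by omega, ?_, ?_, ?_⟩
  · simp [stageParam, take_length]
  · simp [stagePrec, take_length]
  · rw [Readable, degBound_take (by omega), take_length, stagePrec, take_length]
    simp only [Nat.unpair_pair]
    omega

theorem approximates_of_names (hp : Represented.Names p P) (s : ℕ) :
    Approximates (fun i => ratOf (p (Nat.pair i s + 1))) (p 0) ((2⁻¹ ^ s : ℚ) : ℝ) P :=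
  ⟨hp.1, fun i hi => by simpa using hp.2 i hi s⟩

theorem Readable.approximates {n : ℕ} (h : Readable (take p n)) (hp : Represented.Names p P) :
    Approximates (coeffApprox (take p n) (stagePrec (take p n))) (degBound (take p n))
      ((2⁻¹ ^ stagePrec (take p n) : ℚ) : ℝ) P := by
  rw [degBound_take h.pos]
  exact (approximates_of_names hp _).congr fun i hi => coeffApprox_take h hi

/-- The head of the state is written only on the strength of a `LeadCert`, and later steps append
digits without touching it. -/
theorem eval_ne_zero_of_state_ne_nil (hp : Represented.Names p P) {N n : ℕ}
    (h : (state N (take p n)).length ≠ 0) {x : ℝ} (hx : x ∈ Set.Icc (-1 : ℝ) 1) :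
    (derivative^[(state N (take p n)).getD 0 0] P).eval x ≠ 0 := by
  induction n with
  | zero => simp [state_zero] at h
  | succ n ih =>
    rw [state_succ] at h ⊢
    by_cases h0 : (state N (take p n)).length = 0
    · rw [step, if_pos h0] at h ⊢
      split_ifs at h ⊢ with h1
      · exact (h1.1.2.approximates hp).eval_ne_zero_of_leadCert h1.1.1 h1.2 hx
      · simp at h
    · rcases step_eq_or N (take p n) (state N (take p n)) with h1 | ⟨a, h1⟩
      · rw [h1]
        exact ih h0
      · rw [h1, List.getD_append _ _ _ _ (Nat.pos_of_ne_zero h0)]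
        exact ih h0

/-- If the state stalled at `S`, every parameter and precision would be tried against the same `S`,
including those that yield a certificate. -/
theorem state_changes (hp : Represented.Names p P) (hP : P ≠ 0) (N n : ℕ) :
    ∃ n' ≥ n, state N (take p n') ≠ state N (take p n) := by
  by_contra! hn
  set S := state N (take p n) with hS
  have hstep : ∀ n' ≥ n, step N (take p n') S = S := fun n' hn' => by
    have h := hn (n' + 1) (by omega)
    rwa [state_succ, hn n' hn'] at h
  by_cases h0 : S.length = 0
  · obtain ⟨e, hed, s, hs⟩ := exists_leadCert (approximates_of_names hp) hP
    obtain ⟨n', hn', rfl, rfl, hr⟩ := exists_stage p n e s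
    have h := hstep n' hn'
    rw [step, if_pos h0, if_pos] at h
    · rw [← h] at h0
      simp at h0
    · refine ⟨⟨by rwa [degBound_take hr.pos], hr⟩, ?_⟩
      rw [degBound_take hr.pos, leadCert_congr (fun i hi => coeffApprox_take hr hi) hed]
      exact hs
  · have hdig : ∀ j, stateDigit S j ≤ 1 := stateDigit_state_le_one N p n
    have he0 : (derivative^[S.getD 0 0] P).eval (0 : ℝ) ≠ 0 :=
      eval_ne_zero_of_state_ne_nil hp h0 (by norm_num)
    set l := leftEnd N (nextIndex N S) ((S.length - 1) / N) S
    -- The parameter yields infinitely many test points in the middle third, and only finitely many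
    -- of them are not generic.
    let f : ℕ → ℝ := fun τ =>
      l + (2 / 3) ^ ((S.length - 1) / N) * (1 / 3 + 1 / 3 * ((τ : ℝ) + 1)⁻¹)
    have hf : Function.Injective f := by
      intro τ τ' h
      have h1 : ((2 : ℝ) / 3) ^ ((S.length - 1) / N) ≠ 0 := by positivity
      have h2 := mul_left_cancel₀ h1 (add_left_cancel h)
      have h3 : ((τ : ℝ) + 1)⁻¹ = ((τ' : ℝ) + 1)⁻¹ := by linarith
      exact_mod_cast add_right_cancel (inv_injective h3)
    obtain ⟨_, ⟨τ, rfl⟩, hτ⟩ := (Set.infinite_range_of_injective hf).exists_notMem_finite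
      (finite_not_isGeneric he0)
    simp only [Set.mem_ofPred_eq, not_not] at hτ
    have htp : ∀ u, stageParam u = τ → (testPoint N u S : ℝ) = f τ := by
      rintro u rfl
      simp [testPoint, f, l]
    -- The stage `n₁` serves only to name the rational test point; its precision is irrelevant. The
    -- sufficient precision `s` for that point is found next and is tried at the stage `n'`.
    obtain ⟨n₁, -, h1τ, -, -⟩ := exists_stage p n τ 0
    obtain ⟨s, hs⟩ := exists_generic_cert (approximates_of_names hp)
      (abs_testPoint_le hdig (take p n₁)) (by rw [htp _ h1τ]; exact hτ)
    obtain ⟨n', hn', h2τ, rfl, hr⟩ := exists_stage p n τ s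
    have h := hstep n' hn'
    rw [step, if_neg h0, if_pos] at h
    · simp at h
    · refine ⟨hr, fun m hm => ?_⟩
      have e1 : testPoint N (take p n') S = testPoint N (take p n₁) S := by
        have := (htp _ h2τ).trans (htp _ h1τ).symm
        exact_mod_cast this
      rw [degBound_take hr.pos, evalApprox_congr (fun i hi => coeffApprox_take hr hi), e1]
      exact hs m (Nat.lt_succ_iff.1 hm)

end Search

theorem state_length_mono (N : ℕ) (p : ℕ → ℕ) :
    Monotone fun n => (state N (take p n)).length := by
  refine monotone_nat_of_le_succ fun n => ?_
  rw [state_succ]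
  rcases step_eq_or N (take p n) (state N (take p n)) with h | ⟨a, h⟩ <;> simp [h]

/-- `b` is the sequence of digits that the computation produces for the candidates, and the
`e`-th derivative of the polynomial has no zero on `[-1, 1]`. -/
structure IsDigitSequence (N : ℕ) (p : ℕ → ℕ) (P : ℝ[X]) (e : ℕ) (b : ℕ → ℕ) : Prop where
  le_one : ∀ m, b m ≤ 1
  stateDigit_eq : ∀ n j, j < (state N (take p n)).length - 1 →
    stateDigit (state N (take p n)) j = b j
  unbounded : ∀ L, ∃ n, L ≤ (state N (take p n)).length
  eval_ne_zero : ∀ x ∈ Set.Icc (-1 : ℝ) 1, (derivative^[e] P).eval x ≠ 0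
  exists_test : ∀ m, ∃ a : ℚ,
    a ∈ Set.Icc (digitSum b N (m % N) (m / N) + 1 / 3 * (2 / 3) ^ (m / N))
      (digitSum b N (m % N) (m / N) + 2 / 3 * (2 / 3) ^ (m / N)) ∧
    a ∈ Set.Icc (0 : ℚ) 1 ∧ IsGeneric P e a ∧
    b m = if m % N + 1 ≤ signChanges P e a then 1 else 0

variable {N : ℕ} {p : ℕ → ℕ} {P : ℝ[X]} {e : ℕ} {b : ℕ → ℕ}

theorem mul_add_lt_of_lt_div {m i t : ℕ} (hi : i < N) (ht : t < m / N) : N * t + i < m := by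
  have h1 := Nat.mul_le_mul_left N (ht : t + 1 ≤ m / N)
  have h2 := Nat.mul_div_le m N
  rw [Nat.mul_succ] at h1
  omega

theorem exists_isDigitSequence (hN : 0 < N) (hp : Represented.Names p P) (hP : P ≠ 0) :
    ∃ e b, IsDigitSequence N p P e b := by
  obtain ⟨β, hβ, hjump⟩ := exists_limit_of_growing (σ := fun n => state N (take p n))
    (state_zero N p) (fun n => by simp only [state_succ]; exact step_eq_or N _ _)
    (state_changes hp hP N)
  have hdig : ∀ n j, j < (state N (take p n)).length - 1 →
      stateDigit (state N (take p n)) j = β (j + 1) := fun n j hj => by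
    rw [stateDigit, hβ n, take_getD]
    omega
  refine ⟨β 0, fun m => β (m + 1), fun m => ?_, hdig, fun L => ?_, fun x hx => ?_, fun m => ?_⟩
  · obtain ⟨n, -, h⟩ := hjump (m + 1)
    rw [← hdig (n + 1) m (by omega)]
    exact stateDigit_state_le_one N p (n + 1) m
  · obtain ⟨n, h, -⟩ := hjump L
    exact ⟨n, h.ge⟩
  · obtain ⟨n, h, -⟩ := hjump 1
    have h0 := eval_ne_zero_of_state_ne_nil hp (N := N) (n := n) (by omega) hx
    rwa [hβ n, take_getD _ (by omega)] at h0
  -- A state of length `m + 1` is the head `e` followed by `m` digits, so the step that leaves it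
  -- writes digit `m`.
  · obtain ⟨n, h, h'⟩ := hjump (m + 1)
    have hd := hdig n
    have hβn := hβ (n + 1)
    have he : (state N (take p n)).getD 0 0 = β 0 := by rw [hβ n, take_getD _ (by omega)]
    rw [h', state_succ] at hβn
    rw [state_succ] at h'
    have hle := stateDigit_state_le_one N p n
    set S := state N (take p n) with hS
    have h0 : S.length ≠ 0 := by omega
    rw [step, if_neg h0] at hβn h'
    split_ifs at hβn h' with hg
    · have hi : nextIndex N S = m % N := by rw [nextIndex, h, Nat.add_sub_cancel]
      have hr : (S.length - 1) / N = m / N := by rw [h, Nat.add_sub_cancel]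
      have hl : leftEnd N (m % N) (m / N) S =
          digitSum (fun m => β (m + 1)) N (m % N) (m / N) :=
        digitSum_congr fun t ht => hd _ (by
          have := mul_add_lt_of_lt_div (Nat.mod_lt m hN) ht
          omega)
      have htp := testPoint_mem N (take p n) S
      rw [hi, hr, hl] at htp
      have happ := hg.1.approximates hp
      have hab := abs_testPoint_le (N := N) hle (take p n)
      have hgen : ∀ m ≤ β 0, evalError (degBound (take p n)) m (2⁻¹ ^ stagePrec (take p n)) <
          |evalApprox (coeffApprox (take p n) (stagePrec (take p n))) (degBound (take p n)) m
            (testPoint N (take p n) S)| := fun m hm => hg.2 m (by rw [he]; omega)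
      refine ⟨testPoint N (take p n) S, htp, testPoint_mem_unit hle _,
        happ.isGeneric hab hgen, ?_⟩
      have hb : β (m + 1) = nextDigit N (take p n) S := by
        have := congrArg (fun l => List.getD l (m + 1) 0) hβn
        simp only [take_getD β (show m + 1 < m + 1 + 1 by omega)] at this
        rw [← this, List.getD_append_right _ _ _ _ h.le, h]
        simp
      rw [hb, nextDigit, hi, he, happ.signCount_eq hab hgen]
    · omega

namespace IsDigitSequence

theorem leftEnd_eq (h : IsDigitSequence N p P e b) {i n : ℕ} (hi : i < N) :
    leftEnd N i (((state N (take p n)).length - 1) / N) (state N (take p n)) =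
      digitSum b N i (((state N (take p n)).length - 1) / N) :=
  digitSum_congr fun _ ht => h.stateDigit_eq _ _ (mul_add_lt_of_lt_div hi ht)

theorem codeSum_eq (h : IsDigitSequence N p P e b) (n : ℕ) :
    codeSum (stateDigit (state N (take p n))) ((state N (take p n)).length - 1) =
      codeSum b ((state N (take p n)).length - 1) :=
  codeSum_congr fun t ht => h.stateDigit_eq n t ht

theorem tendsto_digitSum (h : IsDigitSequence N p P e b) (i : ℕ) :
    Filter.Tendsto (fun n => (digitSum b N i n : ℝ)) Filter.atTop (nhds (digitLim b N i)) := by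
  refine tendsto_iff_dist_tendsto_zero.2 (squeeze_zero (fun _ => dist_nonneg) (fun n => ?_)
    (tendsto_pow_atTop_nhds_zero_of_lt_one (r := (2 / 3 : ℝ)) (by norm_num) (by norm_num)))
  rw [Real.dist_eq, abs_le]
  have h1 := digitSum_le_digitLim h.le_one N i n
  have h2 := digitLim_le h.le_one N i n
  have h3 : (0 : ℝ) ≤ (2 / 3) ^ n := by positivity
  constructor <;> linarith

theorem exists_digitLim_eq (h : IsDigitSequence N p P e b) (hdeg : P.natDegree ≤ N) {c : ℝ}
    (hc : c ∈ Set.Icc (0 : ℝ) 1) (h0 : P.eval c = 0) : ∃ i < N, digitLim b N i = c := by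
  obtain ⟨i, hie, hi⟩ := exists_threshold h.eval_ne_zero hc h0
  -- Derivatives of order above the degree vanish identically, so there are enough candidates for
  -- all thresholds.
  have heN : e ≤ N := by
    by_contra hn
    have := h.eval_ne_zero 0 (by norm_num)
    rw [iterate_derivative_eq_zero (by omega)] at this
    simp at this
  have hiN : i < N := hie.trans_le heN
  refine ⟨i, hiN, ?_⟩
  -- The root never leaves the interval of its candidate. With test point `a` in the middle third,
  -- `a < c` keeps `c` in the right two thirds (digit `1`), and `c ≤ a` keeps it in the left two
  -- thirds (digit `0`).
  have key : ∀ n, (digitSum b N i n : ℝ) ≤ c ∧ c ≤ digitSum b N i n + (2 / 3) ^ n := by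
    intro n
    induction n with
    | zero => simpa [digitSum] using hc
    | succ n ih =>
      obtain ⟨a, ha, ha01, hg, hb⟩ := h.exists_test (N * n + i)
      have e1 : (N * n + i) % N = i := by rw [Nat.mul_add_mod, Nat.mod_eq_of_lt hiN]
      have e2 : (N * n + i) / N = n := by
        rw [Nat.mul_add_div (by omega), Nat.div_eq_of_lt hiN, add_zero]
      rw [e1, e2] at ha
      rw [e1] at hb
      have ha1 := (Rat.cast_le (K := ℝ)).2 ha.1
      have ha2 := (Rat.cast_le (K := ℝ)).2 ha.2
      push_cast at ha1 ha2
      have hac := hi a ⟨by exact_mod_cast ha01.1, by exact_mod_cast ha01.2⟩ hg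
      have hpos : (0 : ℝ) ≤ (2 / 3) ^ n := by positivity
      rw [digitSum_succ]
      push_cast
      rw [pow_succ]
      split_ifs at hb with hs
      · have := hac.1 hs
        rw [hb, Nat.cast_one]
        constructor <;> linarith [ih.2]
      · have : ¬ (a : ℝ) < c := fun h => hs (hac.2 h)
        rw [hb, Nat.cast_zero]
        constructor <;> linarith [ih.1, not_lt.1 this]
  refine tendsto_nhds_unique (h.tendsto_digitSum i) ?_
  refine tendsto_iff_dist_tendsto_zero.2 (squeeze_zero (fun _ => dist_nonneg) (fun n => ?_)
    (tendsto_pow_atTop_nhds_zero_of_lt_one (r := (2 / 3 : ℝ)) (by norm_num) (by norm_num)))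
  rw [Real.dist_eq, abs_le]
  have h3 : (0 : ℝ) ≤ (2 / 3) ^ n := by positivity
  constructor <;> linarith [(key n).1, (key n).2]

theorem exists_nonroot (h : IsDigitSequence N p P e b) (hp : Represented.Names p P) {i : ℕ}
    (hi : i < N) (h0 : P.eval (digitLim b N i) ≠ 0) : ∃ n, nonroot N (take p n) = i + 1 := by
  have hN : 0 < N := by omega
  obtain ⟨s, hs⟩ := exists_lipBound_cert (approximates_of_names hp)
    (l := digitSum b N i) (fun n => by
      rw [abs_of_nonneg (digitSum_nonneg _ _ _ _)]
      have h1 := digitSum_add_le_one h.le_one N i n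
      have h2 : (0 : ℚ) ≤ (2 / 3) ^ n := by positivity
      linarith) (h.tendsto_digitSum i) h0
  obtain ⟨R, hR⟩ := Filter.eventually_atTop.1 hs
  -- Length `N * R + 1` means the head and `R` complete rounds of digits for all `N` candidates.
  obtain ⟨n₀, hn₀⟩ := h.unbounded (N * R + 1)
  obtain ⟨n, hn, rfl, rfl, hr⟩ := exists_stage p n₀ i s
  refine ⟨n, ?_⟩
  rw [nonroot, if_pos]
  refine ⟨⟨hi, hr⟩, ?_⟩
  have hlen : N * R + 1 ≤ (state N (take p n)).length := hn₀.trans (state_length_mono N p hn)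
  have hRle : R ≤ ((state N (take p n)).length - 1) / N :=
    (Nat.le_div_iff_mul_le hN).2 (by rw [mul_comm]; omega)
  rw [h.leftEnd_eq hi, degBound_take hr.pos, evalApprox_congr (fun i hi => coeffApprox_take hr hi),
    lipBound_congr (fun i hi => coeffApprox_take hr hi)]
  exact hR _ hRle

end IsDigitSequence

/-- A candidate is rejected only if the polynomial has no zero in its current interval. -/
theorem eval_ne_zero_of_nonroot (hp : Represented.Names p P) {n i : ℕ}
    (h : nonroot N (take p n) = i + 1) : i < N ∧ ∀ x ∈ Set.Icc
      (leftEnd N i (((state N (take p n)).length - 1) / N) (state N (take p n)) : ℝ)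
      (leftEnd N i (((state N (take p n)).length - 1) / N) (state N (take p n)) +
        (2 / 3) ^ (((state N (take p n)).length - 1) / N)), P.eval x ≠ 0 := by
  rw [nonroot] at h
  split_ifs at h with hf
  · obtain rfl : stageParam (take p n) = i := by omega
    refine ⟨hf.1.1, fun x hx => ?_⟩
    refine (hf.1.2.approximates hp).eval_ne_zero_of_lipBound (digitSum_nonneg _ _ _ _)
      (digitSum_add_le_one (stateDigit_state_le_one N p n) _ _ _) hf.2 ?_
    push_cast
    exact hx

/-- The final value of a candidate lies in each of its intervals, so an early rejection remains
correct. -/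
theorem IsDigitSequence.eval_ne_zero_of_nonroot (h : IsDigitSequence N p P e b)
    (hp : Represented.Names p P) {n i : ℕ} (hn : nonroot N (take p n) = i + 1) :
    P.eval (digitLim b N i) ≠ 0 := by
  obtain ⟨hi, hx⟩ := Weihrauch.eval_ne_zero_of_nonroot hp hn
  rw [h.leftEnd_eq hi] at hx
  exact hx _ ⟨digitSum_le_digitLim h.le_one _ _ _, digitLim_le h.le_one _ _ _⟩

/-! ## The reduction -/

/-! ### The set of surviving candidates -/

section Removal

variable {N : ℕ} {p : ℕ → ℕ}

theorem removal_take (N : ℕ) (p : ℕ → ℕ) (n : ℕ) [Decidable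
    (∃ j < N, ∀ t ≤ n, nonroot N (take p t) ≠ j + 1)] :
    removal N (take p n) = if ∃ j < N, ∀ t ≤ n, nonroot N (take p t) ≠ j + 1
      then nonroot N (take p n) else 0 := by
  have h : (∃ j < N, ∀ t < (take p n).length + 1, nonroot N ((take p n).take t) ≠ j + 1) ↔
      ∃ j < N, ∀ t ≤ n, nonroot N (take p t) ≠ j + 1 := by
    refine exists_congr fun j => and_congr_right fun _ => forall_congr' fun t => ?_
    rw [take_length, Nat.lt_succ_iff]
    exact forall_congr' fun ht => by rw [take_take p ht]
  rw [removal]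
  simp only [h]

/-- Otherwise consider the index whose removal comes last: by then every candidate has been refuted,
so this very removal would have been suppressed. -/
theorem exists_not_removed (hN : 0 < N) (p : ℕ → ℕ) :
    ∃ i : Fin N, ∀ n, removal N (take p n) ≠ i + 1 := by
  classical
  by_contra! hn
  choose ν hν using hn
  obtain ⟨i, -, hi⟩ := Finset.exists_max_image Finset.univ ν ⟨⟨0, hN⟩, Finset.mem_univ _⟩
  have h := hν i
  rw [removal_take] at h
  split_ifs at h with hj
  · obtain ⟨j, hjN, hj⟩ := hj
    have h' := hν ⟨j, hjN⟩
    rw [removal_take] at h'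
    split_ifs at h'
    exact hj _ (hi ⟨j, hjN⟩ (Finset.mem_univ _)) h'

theorem removal_eq_nonroot {j : ℕ} (hj : j < N) (h : ∀ n, nonroot N (take p n) ≠ j + 1) (n : ℕ) :
    removal N (take p n) = nonroot N (take p n) := by
  classical
  rw [removal_take, if_pos ⟨j, hj, fun t _ => h t⟩]

end Removal

/-- Without digits the listed intervals are `(-1, 0)` and `(1, 2)`, which miss `[0, 1]`. This is why
`removedLeft` adds `(1 / 4) ^ n` and not the sharp tail bound `2 / 3 * (1 / 4) ^ n`, which would
already cut off `(2 / 3, 1]`. -/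
theorem not_mem_removed_of_eq_zero {N : ℕ} {p : ℕ → ℕ} (hp : Represented.Names p (0 : ℝ[X]))
    (x : unitInterval) (n : ℕ) :
    ¬ ((removedLeft N (take p n) : ℝ) < x ∧ (x : ℝ) < removedRight N (take p n)) := by
  have h0 : (state N (take p n)).length = 0 := by
    by_contra h
    exact eval_ne_zero_of_state_ne_nil hp h (x := 0) (by norm_num)
      (by rw [iterate_derivative_zero, eval_zero])
  rw [removedLeft, removedRight, h0]
  have hx0 := x.2.1
  have hx1 := x.2.2
  split_ifs
  · simp [codeSum, hx0]
  · simp [codeSum, hx1]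

namespace IsDigitSequence

variable {N : ℕ} {p : ℕ → ℕ} {P : ℝ[X]} {e : ℕ} {b : ℕ → ℕ}

/-- Even stages cut off points below the partial sum, odd stages points above the partial sum plus a
bound on the tail. Both ends converge to `codeLim b`, so a point on either side is removed at a late
stage of the right parity. -/
theorem eq_codeLim_iff (h : IsDigitSequence N p P e b) (y : unitInterval) :
    (y : ℝ) = codeLim b ↔
      ∀ n, ¬ ((removedLeft N (take p n) : ℝ) < y ∧ (y : ℝ) < removedRight N (take p n)) := by
  have hlow := fun n => codeSum_le_codeLim h.le_one ((state N (take p n)).length - 1)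
  have hupp := fun n => codeLim_le h.le_one ((state N (take p n)).length - 1)
  have hpow : ∀ m : ℕ, (0 : ℝ) < (1 / 4) ^ m := fun m => by positivity
  simp only [removedLeft, removedRight, h.codeSum_eq, take_length]
  constructor
  · rintro hy n ⟨h1, h2⟩
    split_ifs at h1 h2 with hn
    · linarith [hlow n]
    · push_cast at h1
      linarith [hupp n, hpow ((state N (take p n)).length - 1)]
  · intro hy
    have hsmall : ∀ ε > 0, ∃ n₀, ∀ n ≥ n₀,
        (1 / 4 : ℝ) ^ ((state N (take p n)).length - 1) < ε := by
      intro ε hε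
      obtain ⟨m, hm⟩ := exists_pow_lt_of_lt_one hε (show (1 / 4 : ℝ) < 1 by norm_num)
      obtain ⟨n₀, hn₀⟩ := h.unbounded (m + 1)
      refine ⟨n₀, fun n hn => (pow_le_pow_of_le_one (by norm_num) (by norm_num) ?_).trans_lt hm⟩
      have : (state N (take p n₀)).length ≤ _ := state_length_mono N p hn
      simp only at this
      omega
    rcases lt_trichotomy (y : ℝ) (codeLim b) with hlt | heq | hgt
    · obtain ⟨n₀, hn₀⟩ := hsmall _ (sub_pos.2 hlt)
      have hy' := hy (2 * n₀)
      have hs := hn₀ (2 * n₀) (by omega)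
      rw [if_pos (by omega), if_pos (by omega)] at hy'
      refine absurd ⟨?_, ?_⟩ hy'
      · push_cast
        linarith [y.2.1]
      · linarith [hupp (2 * n₀), hpow ((state N (take p (2 * n₀))).length - 1)]
    · exact heq
    · obtain ⟨n₀, hn₀⟩ := hsmall _ (sub_pos.2 hgt)
      have hy' := hy (2 * n₀ + 1)
      have hs := hn₀ (2 * n₀ + 1) (by omega)
      rw [if_neg (by omega), if_neg (by omega)] at hy'
      refine absurd ⟨?_, ?_⟩ hy'
      · push_cast
        linarith [hlow (2 * n₀ + 1)]
      · push_cast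
        linarith [y.2.2]

end IsDigitSequence

/-- The instance of `AoUC × C N` which is computed from a name of a polynomial. -/
theorem exists_instance {N : ℕ} (hN : 0 < N) {p : ℕ → ℕ} {P : ℝ[X]}
    (hp : Represented.Names p P) (hdeg : P.natDegree ≤ N) :
    ∃ (A : TopologicalSpace.Closeds unitInterval) (B : Set (Fin N)),
      (∀ x : unitInterval, x ∈ A ↔ ∀ n,
        ¬ ((removedLeft N (take p n) : ℝ) < x ∧ (x : ℝ) < removedRight N (take p n))) ∧
      (∀ i : Fin N, i ∈ B ↔ ∀ n, removal N (take p n) ≠ i + 1) ∧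
      (AoUC A).Nonempty ∧ B.Nonempty ∧
      ∀ x ∈ A, ∀ i ∈ B, (⟨curve N i x, curve_mem N i x⟩ : unitInterval) ∈ BRoot P := by
  obtain ⟨i₀, hi₀⟩ := exists_not_removed hN p
  rcases eq_or_ne P 0 with rfl | hP
  -- For `P = 0` nothing is removed from `[0, 1]`, and every value in the range of `curve` is a
  -- root.
  · refine ⟨⊤, {i | ∀ n, removal N (take p n) ≠ i + 1}, fun x => ⟨fun _ n => ?_, fun _ => ?_⟩,
      fun i => Iff.rfl, ⟨0, Or.inl rfl, Set.mem_univ _⟩, ⟨i₀, hi₀⟩, fun x _ i _ _ => ?_⟩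
    · exact not_mem_removed_of_eq_zero hp x n
    · exact Set.mem_univ _
    · exact eval_zero
  · obtain ⟨e, b, h⟩ := exists_isDigitSequence hN hp hP
    let z : unitInterval := ⟨codeLim b, codeLim_mem h.le_one⟩
    refine ⟨⟨{z}, isClosed_singleton⟩, {i | ∀ n, removal N (take p n) ≠ i + 1}, fun x => ?_,
      fun i => Iff.rfl, ⟨z, Or.inr ⟨z, rfl⟩, rfl⟩, ⟨i₀, hi₀⟩, ?_⟩
    · rw [← h.eq_codeLim_iff]
      exact Subtype.ext_iff
    · rintro x hx i hi ⟨c, hc⟩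
      obtain rfl : x = z := hx
      obtain ⟨j, hjN, hj⟩ := h.exists_digitLim_eq hdeg c.2 hc
      -- The candidate `j` equal to the root `c` is never refuted, so no removal is suppressed and a
      -- surviving `i` cannot be a non-root.
      have hrem := removal_eq_nonroot hjN fun n hn => h.eval_ne_zero_of_nonroot hp hn (hj ▸ hc)
      change P.eval (curve N i (codeLim b)) = 0
      rw [curve_codeLim h.le_one]
      by_contra h0
      obtain ⟨n, hn⟩ := h.exists_nonroot hp i.2 h0
      exact hi n ((hrem n).trans hn)

theorem abs_curveApprox_sub_lt {N i : ℕ} (hi : i < N) (n : ℕ) {r : ℚ} {x : ℝ}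
    (hx : x ∈ Set.Icc (0 : ℝ) 1) (h : |(r : ℝ) - x| < 2⁻¹ ^ curvePrec N n) :
    |(curveApprox N i n r : ℝ) - curve N i x| < 2⁻¹ ^ n := by
  have h1 : |((max (min r 1) 0 : ℚ) : ℝ) - x| ≤ 2⁻¹ ^ curvePrec N n := by
    refine le_trans ?_ h.le
    push_cast
    have e : x = max (min x 1) 0 := by rw [min_eq_left hx.2, max_eq_left hx.1]
    conv_lhs => rw [e]
    refine (abs_max_sub_max_le_abs _ _ _).trans ((abs_min_sub_min_le_max _ _ _ _).trans ?_)
    simp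
  refine (abs_curveSum_sub_curve_le hi (2 * n + 2) h1).trans_lt ?_
  -- `curvePrec` is chosen so that the frequency factor cancels. With `2 * n + 2` terms the total
  -- error is `3/8 * (1/16)^n + 4/9 * (4/9)^n`, and `3/8 + 4/9 < 1`.
  have e1 : (6 : ℝ) * 4 ^ (N * (2 * n + 2)) * 2⁻¹ ^ curvePrec N n = 6 / 16 * (1 / 16) ^ n := by
    have h2 : curvePrec N n = 2 * (N * (2 * n + 2)) + 4 * (n + 1) := by
      rw [curvePrec]
      ring
    have h3 : (4 : ℝ) ^ (N * (2 * n + 2)) * (2⁻¹ ^ 2) ^ (N * (2 * n + 2)) = 1 := by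
      rw [← mul_pow]
      norm_num
    rw [h2, pow_add, pow_mul 2⁻¹ 2, pow_mul 2⁻¹ 4, show (2⁻¹ ^ 4 : ℝ) = 1 / 16 by norm_num, pow_succ]
    linear_combination 6 / 16 * (1 / 16 : ℝ) ^ n * h3
  have e2 : ((2 : ℝ) / 3) ^ (2 * n + 2) = 4 / 9 * (4 / 9) ^ n := by
    rw [show 2 * n + 2 = 2 * (n + 1) by ring, pow_mul, pow_succ]
    norm_num
    ring
  have l1 : (1 / 16 : ℝ) ^ n ≤ 2⁻¹ ^ n := pow_le_pow_left₀ (by norm_num) (by norm_num) n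
  have l2 : (4 / 9 : ℝ) ^ n ≤ 2⁻¹ ^ n := pow_le_pow_left₀ (by norm_num) (by norm_num) n
  have hpos : (0 : ℝ) < 2⁻¹ ^ n := by positivity
  rw [e1, e2]
  linarith

theorem two_mul_add_one_le_three_pow (k : ℕ) : 2 * k + 1 ≤ 3 ^ k := by
  induction k with
  | zero => simp
  | succ k ih =>
    rw [pow_succ]
    omega

/-- Places `2 * n` and `2 * n + 1` of the output carry the interval and the removal of stage `n`, as
the pairing of names requires. -/
theorem exists_computable_instance (N : ℕ) : ∃ H : (ℕ → ℕ) → ℕ → ℕ,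
    (ComputableFun fun p => Part.some (H p)) ∧ ∀ p n,
      ratOf (H p (2 * n)).unpair.1 = removedLeft N (take p n) ∧
      ratOf (H p (2 * n)).unpair.2 = removedRight N (take p n) ∧
      H p (2 * n + 1) = removal N (take p n) := by
  obtain ⟨l, hl, hl'⟩ := primrecRat_removedLeft N
  obtain ⟨r, hr, hr'⟩ := primrecRat_removedRight N
  have hu : Primrec fun x : ℕ × List ℕ => x.2.take (x.1 / 2) :=
    Primrec.list_take.comp (Primrec.nat_div.comp Primrec.fst (Primrec.const 2)) Primrec.snd
  have hg : Primrec₂ fun (n : ℕ) (u : List ℕ) => if n % 2 = 0 then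
      Nat.pair (l (u.take (n / 2))) (r (u.take (n / 2))) else removal N (u.take (n / 2)) :=
    Primrec.ite (Primrec.eq.comp (Primrec.nat_mod.comp Primrec.fst (Primrec.const 2))
      (Primrec.const 0)) (Primrec₂.natPair.comp (hl.comp hu) (hr.comp hu))
      ((primrec_removal N).comp hu)
  refine ⟨_, computableFun_of_primrec hg one_pos, fun p n => ?_⟩
  have e1 : (2 * n + 1) % 2 ≠ 0 := by omega
  have e2 : (2 * n + 1) / 2 = n := by omega
  have t1 : (take p (1 * (2 * n + 1))).take n = take p n := take_take p (by omega)
  have t2 : (take p (1 * (2 * n + 1 + 1))).take n = take p n := take_take p (by omega)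
  simp only [Nat.mul_mod_right, if_true, Nat.mul_div_cancel_left n two_pos, e1, if_false, e2,
    t1, t2, Nat.unpair_pair, hl', hr', and_self]

/-- The argument is `⟨p, q⟩` where `q` pairs a name of the real with a name of the index. The index
is therefore at place `3`, and approximation `m` of the real at place `4 * m + 1`. -/
theorem exists_computable_curve (N : ℕ) : ∃ K : (ℕ → ℕ) → ℕ → ℕ,
    (ComputableFun fun r => Part.some (K r)) ∧ ∀ r n,
      ratOf (K r n) = curveApprox N (r 3) n (ratOf (r (4 * curvePrec N n + 1))) := by
  have hi : Primrec fun x : ℕ × List ℕ => x.2.getD 3 0 :=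
    (Primrec.list_getD 0).comp Primrec.snd (Primrec.const 3)
  have hs : Primrec fun x : ℕ × List ℕ => 4 * curvePrec N x.1 + 1 :=
    Primrec.succ.comp (Primrec.nat_mul.comp (Primrec.const 4) (Primrec.nat_mul.comp
      (Primrec.const (4 * N + 4)) (Primrec.succ.comp Primrec.fst)))
  obtain ⟨g, hg, hg'⟩ := PrimrecRat.curveApprox N hi Primrec.fst
    (PrimrecRat.ratOf ((Primrec.list_getD 0).comp Primrec.snd hs))
  refine ⟨_, computableFun_of_primrec (g := fun n u => g (n, u)) hg
    -- Both places read for output `n`, `3` and `4 * curvePrec N n + 1 = (16 * N + 16) * (n + 1) +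
    -- 1`, are below `(16 * N + 18) * (n + 1)`.
    (show 0 < 16 * N + 18 by omega), fun r n => ?_⟩
  have h1 : 3 < (16 * N + 18) * (n + 1) := by nlinarith
  have h2 : 4 * curvePrec N n + 1 < (16 * N + 18) * (n + 1) := by
    rw [curvePrec]
    nlinarith
  rw [hg']
  simp only [take_getD r h1, take_getD r h2]

end Weihrauch

theorem proposition10 (k : ℕ) :
    Weihrauch.Reducible (Weihrauch.BRootLE (2 * k + 1))
      (Weihrauch.prod Weihrauch.AoUC (Weihrauch.C (3 ^ k))) := by
  open Weihrauch in
  obtain ⟨H, hH, hH'⟩ := exists_computable_instance (3 ^ k)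
  obtain ⟨K, hK, hK'⟩ := exists_computable_curve (3 ^ k)
  refine ⟨_, _, hH, hK, fun G hG p P hp hne => ?_⟩
  obtain ⟨x₀, hdeg, -⟩ := hne
  obtain ⟨A, B, hA, hB, ⟨z, hz⟩, ⟨i, hi⟩, hroot⟩ := exists_instance (pow_pos three_pos k) hp
    ((natDegree_le_iff_degree_le.2 hdeg).trans (two_mul_add_one_le_three_pow k))
  have hnames : Represented.Names (H p) (A, B) := by
    refine ⟨fun x => (hA x).trans (forall_congr' fun n => ?_),
      fun i => (hB i).trans (forall_congr' fun n => ?_)⟩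
    · rw [InInterval, (hH' p n).1, (hH' p n).2.1]
    · rw [← (hH' p n).2.2]
  obtain ⟨q, hq, ⟨x, j⟩, ⟨hx, hj⟩, hqx, hqj⟩ := hG (H p) (A, B) hnames ⟨(z, i), hz, hi⟩
  refine ⟨K (interleave p q), ?_, ⟨curve (3 ^ k) j x, curve_mem _ _ _⟩,
    ⟨hdeg, hroot x hx.2 j hj⟩, fun n => ?_⟩
  · exact Part.mem_bind (Part.mem_some _) (Part.mem_bind hq (Part.mem_some _))
  · have e1 : interleave p q 3 = j := hqj
    have e2 : interleave p q (4 * curvePrec (3 ^ k) n + 1) = q (2 * curvePrec (3 ^ k) n) := by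
      rw [interleave, if_neg (by omega)]
      congr 1
      omega
    rw [hK', e1, e2]
    exact abs_curveApprox_sub_lt j.2 n x.2 (hqx _)
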